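/- Let $n\ge 3$ and let $(M^n,g)$ be an asymptotically flat end: $M$ is identified with the complement of a ball in $\mathbb R^n$ by coordinates $x=(x^1,\dots,x^n)$, and $g=(g_{ij})$ is a Riemannian metric there with $$g_{ij}-\delta_{ij}=o_2\big(|x|^{-\frac{n-2}{2}}\big)\qquad (1\le i,j\le n),$$ where $f=o_k(|x|^{-\tau})$ means that $f$ is $C^k$ near infinity and $|x|^{|\alpha|+\tau}\,|\partial^\alpha f(x)|\to 0$ as $x\to\infty$ for every multi-index $\alpha$ with $0\le|\alpha|\le k$. For a bounded open set $D\subset\mathbb R^n$ with Lipschitz boundary $\Sigma=\partial D$ contained in the end put (summing over repeated indices) $$\mathfrak m(\Sigma)=\frac{1}{2(n-1)\omega_{n-1}}\int_{\Sigma}(g_{ij,j}-g_{jj,i})\,\nu_e^i\,d\sigma_e,\qquad \mathfrak m_{I}(\Sigma)=\frac{1}{(n-1)(2-n)\omega_{n-1}}\int_{\Sigma}\Big(\mathrm{Ric}-\tfrac12 R_g\,g\Big)(X,\nu_g)\,d\sigma_g ,$$ where $\omega_{n-1}$ is the area of the unit sphere in $\mathbb R^n$, $\nu_e,d\sigma_e$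 (resp. $\nu_g,d\sigma_g$) are the unit normal pointing out of $D$ and the area element of $\Sigma$ with respect to the Euclidean metric (resp. $g$), $\mathrm{Ric}$ and $R_g$ are the Ricci tensor and the scalar curvature of $g$, and $X=x^i\,\partial/\partial x^i$. For large $r$ write $\mathfrak m(r),\mathfrak m_I(r)$ for these quantities on $S_r=\partial\{|x|<r\}$. Then $$\lim_{r\to\infty}\big(\mathfrak m(r)-\mathfrak m_I(r)\big)=0 .$$ More generally, let $\{D_l\}_{l\ge1}$ be a sequence of bounded open subsets of $\mathbb R^n$ with Lipschitz boundaries $\Sigma_l=\partial D_l$, let $|\Sigma_l|$ be the area of $\Sigma_l$ and $r_l=\inf_{x\in\Sigma_l}|x|$. If $r_l\to\infty$ as $l\to\infty$ and $|\Sigma_l|\le C\,r_l^{\,n-1}$ for some constant $C$ independent of $l$, then $$\lim_{l\to\infty}\big(\mathfrak m(\Sigma_l)-\mathfrak m_I(\Sigma_l)\big)=0 .$$ (For all large $r$, respectively all large $l$, the surfaces lie in the end and the integrals converge absolutely.) -/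

import Mathlib

open MeasureTheory Filter Topology
open scoped NNReal ENNReal InnerProductSpace

noncomputable section

namespace AFEnd

/-- Euclidean space `ℝⁿ`, carrying the coordinates `x¹, …, xⁿ`. -/
abbrev E (n : ℕ) := EuclideanSpace ℝ (Fin n)

/-- The coordinate components `g_ij(x)` of a metric. -/
abbrev MetricField (n : ℕ) := E n → Matrix (Fin n) (Fin n) ℝ

/-! ### Partial derivatives and decay classes -/

/-- The partial derivative `∂_i f`. -/
def pderiv {n : ℕ} (i : Fin n) (f : E n → ℝ) (x : E n) : ℝ :=
  fderiv ℝ f x (EuclideanSpace.single i 1)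

/-- The iterated partial derivative `∂_{i₁} ⋯ ∂_{i_m} f`; the list `[i₁, …, i_m]` plays the role of
a multi-index of order `m`. -/
def iterPderiv {n : ℕ} : List (Fin n) → (E n → ℝ) → E n → ℝ
  | [], f => f
  | i :: α, f => pderiv i (iterPderiv α f)

/-- `f = o_k(|x|^{-τ})`: near infinity `f` is `C^k`, and `|x|^{|α|+τ} |∂^α f(x)| → 0` as `x → ∞`
for all `α` with `0 ≤ |α| ≤ k`. -/
def IsLittleOk {n : ℕ} (k : ℕ) (τ : ℝ) (f : E n → ℝ) : Prop :=
  (∃ R : ℝ, ContDiffOn ℝ k f {x | R < ‖x‖}) ∧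
  ∀ α : List (Fin n), α.length ≤ k →
    Tendsto (fun x : E n => ‖x‖ ^ ((α.length : ℝ) + τ) * |iterPderiv α f x|)
      (Bornology.cobounded (E n)) (𝓝 0)

/-! ### Curvature in coordinates -/

/-- The partial derivative `g_{ij,k}`. -/
def dg {n : ℕ} (g : MetricField n) (i j k : Fin n) (x : E n) : ℝ :=
  pderiv k (fun y => g y i j) x

/-- Christoffel symbols `Γ^k_{ij} = ½ g^{kl} (g_{jl,i} + g_{il,j} - g_{ij,l})`. -/
def christoffel {n : ℕ} (g : MetricField n) (k i j : Fin n) (x : E n) : ℝ :=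
  (1 / 2) * ∑ l, (g x)⁻¹ k l * (dg g j l i x + dg g i l j x - dg g i j l x)

/-- Ricci tensor
`R_ij = ∂_k Γ^k_{ji} - ∂_j Γ^k_{ki} + Γ^k_{kl} Γ^l_{ji} - Γ^k_{jl} Γ^l_{ki}`. -/
def ricci {n : ℕ} (g : MetricField n) (i j : Fin n) (x : E n) : ℝ :=
  ∑ k, pderiv k (christoffel g k j i) x - ∑ k, pderiv j (christoffel g k k i) x
    + ∑ k, ∑ l, christoffel g k k l x * christoffel g l j i x
    - ∑ k, ∑ l, christoffel g k j l x * christoffel g l k i x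

/-- Scalar curvature `R_g = g^{ij} R_ij`. -/
def scalarCurv {n : ℕ} (g : MetricField n) (x : E n) : ℝ :=
  ∑ i, ∑ j, (g x)⁻¹ i j * ricci g i j x

/-! ### Lipschitz domains, normals and area -/

/-- `D` has Lipschitz boundary: near each boundary point, in suitable Euclidean coordinates with
last axis `v`, the set `D` is the region strictly below the graph of a Lipschitz function on the
hyperplane `v^⊥`. -/
def HasLipschitzBoundary {n : ℕ} (D : Set (E n)) : Prop :=
  ∀ p ∈ frontier D, ∃ (v : E n) (K : ℝ≥0) (φ : (ℝ ∙ v)ᗮ → ℝ) (U : Set (E n)),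
    ‖v‖ = 1 ∧ LipschitzWith K φ ∧ IsOpen U ∧ p ∈ U ∧
    ∀ x ∈ U, x ∈ D ↔ ⟪v, x⟫_ℝ < φ ((ℝ ∙ v)ᗮ.orthogonalProjectionOnto x)

/-- `ν` is the Euclidean unit outward normal to `D` at the boundary point `x`: to first order at
`x`, the set `D` is the half-space `{y | ⟨y - x, ν⟩ < 0}`. -/
def IsOutwardNormal {n : ℕ} (D : Set (E n)) (x ν : E n) : Prop :=
  ‖ν‖ = 1 ∧ ∀ ε > 0, ∀ᶠ y in 𝓝 x,
    (ε * ‖y - x‖ < ⟪y - x, ν⟫_ℝ → y ∉ D) ∧ (⟪y - x, ν⟫_ℝ < -(ε * ‖y - x‖) → y ∈ D)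

/-- The outward normal is unique where it exists. -/
theorem IsOutwardNormal.eq {n : ℕ} {D : Set (E n)} {x ν ν' : E n}
    (h : IsOutwardNormal D x ν) (h' : IsOutwardNormal D x ν') : ν = ν' := by
  by_contra hne
  have hlt : ⟪ν, ν'⟫_ℝ < 1 := by
    rw [inner_lt_one_iff_real_of_norm_eq_one h.1 h'.1]
    exact hne
  set w := ν - ν' with hw
  have hwpos : 0 < ‖w‖ := norm_pos_iff.2 (sub_ne_zero.2 hne)
  have h1 : ⟪w, ν⟫_ℝ = 1 - ⟪ν, ν'⟫_ℝ := by
    rw [hw, inner_sub_left, real_inner_self_eq_norm_sq, h.1, real_inner_comm ν' ν]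
    norm_num [real_inner_comm]
  have h2 : ⟪w, ν'⟫_ℝ = -(1 - ⟪ν, ν'⟫_ℝ) := by
    rw [hw, inner_sub_left, real_inner_self_eq_norm_sq, h'.1]
    ring
  set c := 1 - ⟪ν, ν'⟫_ℝ with hc
  have hcpos : 0 < c := by linarith
  have hε : 0 < c / (2 * ‖w‖) := by positivity
  have hlim : Tendsto (fun t : ℝ => x + t • w) (𝓝[>] 0) (𝓝 x) := by
    have : Tendsto (fun t : ℝ => x + t • w) (𝓝 0) (𝓝 (x + (0 : ℝ) • w)) :=
      Continuous.tendsto (by fun_prop) 0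
    rw [zero_smul, add_zero] at this
    exact this.mono_left nhdsWithin_le_nhds
  obtain ⟨t, ⟨ha, hb⟩, ht⟩ := ((hlim.eventually (h.2 _ hε)).and
    (hlim.eventually (h'.2 _ hε)) |>.and self_mem_nhdsWithin).exists
  have ht' : 0 < t := ht
  have hn : c / (2 * ‖w‖) * ‖t • w‖ = t * c / 2 := by
    rw [norm_smul, Real.norm_of_nonneg ht'.le]
    field_simp
  have htc : 0 < t * c := mul_pos ht' hcpos
  refine ha.1 ?_ (hb.2 ?_)
  · rw [add_sub_cancel_left, hn, real_inner_smul_left, h1]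
    linarith
  · rw [add_sub_cancel_left, hn, real_inner_smul_left, h2]
    linarith

open Classical in
/-- The Euclidean unit outward normal `ν_e` of `D` at `x`. It is unique where it exists; on the
boundary of a Lipschitz domain it exists almost everywhere, and its value `0` at the remaining
points is immaterial. -/
def normalE {n : ℕ} (D : Set (E n)) (x : E n) : E n :=
  if h : ∃ ν, IsOutwardNormal D x ν then h.choose else 0

/-- `g^{ij} ν_i ν_j`, where `ν` is the Euclidean normal regarded as a covector. -/
def conormSq {n : ℕ} (g : MetricField n) (D : Set (E n)) (x : E n) : ℝ :=
  ∑ i, ∑ j, (g x)⁻¹ i j * normalE D x i * normalE D x j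

/-- The unit outward normal with respect to `g`: `ν_g^i = g^{ij} ν_j / (g^{kl} ν_k ν_l)^{1/2}`
with `ν = ν_e`. It is the `g`-unit vector that is `g`-orthogonal to the tangent hyperplane `ν_e^⊥`
and points out of `D`. -/
def normalG {n : ℕ} (g : MetricField n) (D : Set (E n)) (x : E n) (i : Fin n) : ℝ :=
  (∑ j, (g x)⁻¹ i j * normalE D x j) / Real.sqrt (conormSq g D x)

/-- The density `dσ_g / dσ_e = (det g)^{1/2} (g^{kl} ν_k ν_l)^{1/2}` of the area element induced
by `g` on `∂D` with respect to the Euclidean one; it is the square root of the determinant of `g`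
restricted to the tangent hyperplane `ν_e^⊥`, in a Euclidean orthonormal basis. -/
def areaDensity {n : ℕ} (g : MetricField n) (D : Set (E n)) (x : E n) : ℝ :=
  Real.sqrt ((g x).det) * Real.sqrt (conormSq g D x)

/-! ### The two masses -/

/-- The area `ω_{n-1}` of the unit sphere in `ℝⁿ`. -/
def sphereArea (n : ℕ) : ℝ := (μHE[n - 1] (Metric.sphere (0 : E n) 1)).toReal

/-- The ADM integrand `(g_{ij,j} - g_{jj,i}) ν_e^i`. -/
def admIntegrand {n : ℕ} (g : MetricField n) (D : Set (E n)) (x : E n) : ℝ :=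
  ∑ i, ∑ j, (dg g i j j x - dg g j j i x) * normalE D x i

/-- The ADM mass flux `1 / (2(n-1)ω_{n-1}) ∫_{∂D} (g_{ij,j} - g_{jj,i}) ν_e^i dσ_e`. -/
def admMass {n : ℕ} (g : MetricField n) (D : Set (E n)) : ℝ :=
  1 / (2 * ((n : ℝ) - 1) * sphereArea n) * ∫ x in frontier D, admIntegrand g D x ∂μHE[n - 1]

/-- The integrand `(Ric - ½ R_g g)(X, ν_g) dσ_g / dσ_e`, where `X = x^i ∂_i`. -/
def ricciIntegrand {n : ℕ} (g : MetricField n) (D : Set (E n)) (x : E n) : ℝ :=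
  (∑ i, ∑ j, (ricci g i j x - 1 / 2 * scalarCurv g x * g x i j) * x i * normalG g D x j)
    * areaDensity g D x

/-- The Ricci mass flux
`1 / ((n-1)(2-n)ω_{n-1}) ∫_{∂D} (Ric - ½ R_g g)(X, ν_g) dσ_g`. -/
def ricciMass {n : ℕ} (g : MetricField n) (D : Set (E n)) : ℝ :=
  1 / (((n : ℝ) - 1) * (2 - (n : ℝ)) * sphereArea n) *
    ∫ x in frontier D, ricciIntegrand g D x ∂μHE[n - 1]

/-- Both flux integrals over `∂D` converge absolutely. -/
def FluxesExist {n : ℕ} (g : MetricField n) (D : Set (E n)) : Prop :=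
  IntegrableOn (admIntegrand g D) (frontier D) μHE[n - 1] ∧
  IntegrableOn (ricciIntegrand g D) (frontier D) μHE[n - 1]

/-- `r = inf_{x ∈ ∂D} |x|`. -/
def innerRadius {n : ℕ} (D : Set (E n)) : ℝ := ⨅ x : frontier D, ‖(x : E n)‖

end AFEnd

end

/-! Put h = g - δ and τ = (n-2)/2. Up to an error o(|x|^(-2τ-2)) the Einstein tensor of g is a
linear expression G in the second derivatives of h, and replacing ν_g dσ_g by ν_e dσ_e costs a
relative error o(|x|^(-τ)). Contraction with X loses one power of |x|. Hence the Ricci flux is the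
Euclidean flux of G_ij x^i up to a density o(|x|^(-2τ-1)) = o(|x|^(-(n-1)))
(`decays_ricciFlux_sub`). On surfaces of area at most C r^(n-1) such an error integrates to o(1);
the decay rate τ is exactly what this requires.

For the linear part there is an exact identity (`sum_linEinstein_mul_coord`): G_ij x^i = ∂_k U_jk -
(n-2)/2 m_j, where m_j = g_{ja,a} - g_{aa,j} is the ADM covector and U is antisymmetric, linear in x
and in the first derivatives of g. The factor -(n-2)/2 is the ratio of the two normalising
constants, so only the flux of ∂_k U_jk is left.

That flux vanishes through every compact Lipschitz boundary in the end
(`integral_divergence_superpotential`): by antisymmetry it is a sum of integrals of tangential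
derivatives (ν_j ∂_k - ν_k ∂_j) U_jk. The argument lives on the surface, which matters because
nothing is known about g inside it.

The vanishing for tangential derivatives is Stokes' theorem on a Lipschitz surface, for C¹ functions
only, since g is merely C². A partition of unity reduces it to a graph of a Lipschitz φ, and the
area formula (`hausdorffMeasure_graphMap_image`) carries it to the base hyperplane. What remains is
that F_a φ_b - F_b φ_a has integral zero for Lipschitz F, φ with F of compact support
(`integral_lineDeriv_mul_lineDeriv_comm`), a weak form of the symmetry of second derivatives. -/

noncomputable section

namespace AFEnd

/-! ### Area of Lipschitz graphs. -/

section Graph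

variable {F : Type*} [NormedAddCommGroup F] [InnerProductSpace ℝ F]

/-- The graph of `φ` over the hyperplane `v^⊥`, parametrized by `v^⊥`. -/
def graphMap (v : F) (φ : (ℝ ∙ v)ᗮ → ℝ) (y : (ℝ ∙ v)ᗮ) : F := (y : F) + φ y • v

theorem inner_orthogonal_span_eq_zero (v : F) (y : (ℝ ∙ v)ᗮ) : ⟪(y : F), v⟫_ℝ = 0 :=
  Submodule.mem_orthogonal_singleton_iff_inner_left.1 y.2

theorem norm_coe_add_smul_sq {v : F} (hv : ‖v‖ = 1) (y : (ℝ ∙ v)ᗮ) (t : ℝ) :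
    ‖(y : F) + t • v‖ ^ 2 = ‖y‖ ^ 2 + t ^ 2 := by
  rw [norm_add_sq_real, inner_smul_right, inner_orthogonal_span_eq_zero, norm_smul, hv]
  simp

theorem graphMap_sub (v : F) (φ : (ℝ ∙ v)ᗮ → ℝ) (x y : (ℝ ∙ v)ᗮ) :
    graphMap v φ x - graphMap v φ y = ((x - y : (ℝ ∙ v)ᗮ) : F) + (φ x - φ y) • v := by
  simp only [graphMap, Submodule.coe_sub, sub_smul]
  abel

theorem norm_graphMap_sub_sq {v : F} (hv : ‖v‖ = 1) (φ : (ℝ ∙ v)ᗮ → ℝ) (x y : (ℝ ∙ v)ᗮ) :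
    ‖graphMap v φ x - graphMap v φ y‖ ^ 2 = ‖x - y‖ ^ 2 + (φ x - φ y) ^ 2 := by
  rw [graphMap_sub, norm_coe_add_smul_sq hv]

theorem norm_sub_le_norm_graphMap_sub {v : F} (hv : ‖v‖ = 1) (φ : (ℝ ∙ v)ᗮ → ℝ)
    (x y : (ℝ ∙ v)ᗮ) : ‖x - y‖ ≤ ‖graphMap v φ x - graphMap v φ y‖ := by
  refine le_of_sq_le_sq ?_ (norm_nonneg _)
  rw [norm_graphMap_sub_sq hv]
  nlinarith [sq_nonneg (φ x - φ y)]

theorem graphMap_injective {v : F} (hv : ‖v‖ = 1) (φ : (ℝ ∙ v)ᗮ → ℝ) :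
    Function.Injective (graphMap v φ) := by
  intro x y h
  have := norm_sub_le_norm_graphMap_sub hv φ x y
  rw [h, sub_self, norm_zero] at this
  exact sub_eq_zero.1 (norm_le_zero_iff.1 this)

/-- Two graphs whose heights have increments differing by at most `δ` times the increment of the
base point have comparable distances. -/
theorem norm_graphMap_sub_le {v : F} (hv : ‖v‖ = 1) {φ ψ : (ℝ ∙ v)ᗮ → ℝ} {δ : ℝ} (hδ : 0 ≤ δ)
    {x y : (ℝ ∙ v)ᗮ} (h : |(φ x - φ y) - (ψ x - ψ y)| ≤ δ * ‖x - y‖) :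
    ‖graphMap v φ x - graphMap v φ y‖ ≤ (1 + δ) * ‖graphMap v ψ x - graphMap v ψ y‖ := by
  have e : graphMap v φ x - graphMap v φ y = (graphMap v ψ x - graphMap v ψ y)
      + ((φ x - φ y) - (ψ x - ψ y)) • v := by
    rw [graphMap_sub, graphMap_sub, sub_smul (φ x - φ y)]
    abel
  calc ‖graphMap v φ x - graphMap v φ y‖
      ≤ ‖graphMap v ψ x - graphMap v ψ y‖ + ‖((φ x - φ y) - (ψ x - ψ y)) • v‖ := by
        rw [e]; exact norm_add_le _ _
    _ ≤ ‖graphMap v ψ x - graphMap v ψ y‖ + δ * ‖x - y‖ := by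
        rw [norm_smul, hv, mul_one, Real.norm_eq_abs]; gcongr
    _ ≤ ‖graphMap v ψ x - graphMap v ψ y‖ + δ * ‖graphMap v ψ x - graphMap v ψ y‖ := by
        gcongr; exact norm_sub_le_norm_graphMap_sub hv ψ x y
    _ = _ := by ring

variable [FiniteDimensional ℝ F] [MeasurableSpace F] [BorelSpace F]

omit [FiniteDimensional ℝ F] in
-- The map between the two graphs that preserves the base point is (1 + δ)-Lipschitz. No regularity
-- of the heights is needed, and the normalising factor of `μHE` cancels.
theorem hausdorffMeasure_graphMap_image_le {v : F} (hv : ‖v‖ = 1) {φ ψ : (ℝ ∙ v)ᗮ → ℝ} {δ : ℝ≥0}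
    {s : Set (ℝ ∙ v)ᗮ}
    (h : ∀ x ∈ s, ∀ y ∈ s, |(φ x - φ y) - (ψ x - ψ y)| ≤ δ * ‖x - y‖) (d : ℕ) :
    μHE[d] (graphMap v φ '' s) ≤ (1 + δ : ℝ≥0) ^ d * μHE[d] (graphMap v ψ '' s) := by
  set G : F → F := fun z => graphMap v φ ((graphMap v ψ).invFun z) with hG
  have hinv : ∀ x, (graphMap v ψ).invFun (graphMap v ψ x) = x :=
    Function.leftInverse_invFun (graphMap_injective hv ψ)
  have hL : LipschitzOnWith (1 + δ) G (graphMap v ψ '' s) := by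
    refine LipschitzOnWith.of_dist_le_mul ?_
    rintro _ ⟨x, hx, rfl⟩ _ ⟨y, hy, rfl⟩
    simp only [hG, hinv, dist_eq_norm]
    exact norm_graphMap_sub_le hv δ.2 (h x hx y hy)
  have him : graphMap v φ '' s = G '' (graphMap v ψ '' s) := by
    rw [Set.image_image]
    simp only [hG, hinv]
  have := hL.hausdorffMeasure_image_le (d := d) (by positivity)
  rw [← him, ENNReal.rpow_natCast] at this
  simp only [Measure.euclideanHausdorffMeasure_def, Measure.smul_apply]
  rw [ENNReal.smul_def, ENNReal.smul_def, smul_eq_mul, smul_eq_mul, mul_left_comm]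
  gcongr

omit [MeasurableSpace F] [BorelSpace F] in
-- In an orthonormal basis of the hyperplane the Gram matrix of the graph map is the identity plus a
-- rank-one matrix, of determinant 1 + |ℓ|².
theorem normDet_graphMap {v : F} (hv : ‖v‖ = 1) (ℓ : (ℝ ∙ v)ᗮ →L[ℝ] ℝ) :
    ((ℝ ∙ v)ᗮ.subtype + (ℓ : (ℝ ∙ v)ᗮ →ₗ[ℝ] ℝ).smulRight v).normDet = √(1 + ‖ℓ‖ ^ 2) := by
  have h0 := LinearMap.normDet_nonneg ((ℝ ∙ v)ᗮ.subtype + (ℓ : (ℝ ∙ v)ᗮ →ₗ[ℝ] ℝ).smulRight v)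
  rw [← Real.sqrt_sq h0]
  congr 1
  set b := stdOrthonormalBasis ℝ (ℝ ∙ v)ᗮ
  have h1 := LinearMap.normDet_sq_eq_det_gram
    ((ℝ ∙ v)ᗮ.subtype + (ℓ : (ℝ ∙ v)ᗮ →ₗ[ℝ] ℝ).smulRight v) b
  have h2 : Matrix.gram ℝ (fun i => ((ℝ ∙ v)ᗮ.subtype + (ℓ : (ℝ ∙ v)ᗮ →ₗ[ℝ] ℝ).smulRight v) (b i))
      = 1 + Matrix.replicateCol Unit (fun i => ℓ (b i)) *
          Matrix.replicateRow Unit (fun i => ℓ (b i)) := by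
    ext i j
    have hb : ⟪(b i : F), (b j : F)⟫_ℝ = (1 : Matrix _ _ ℝ) i j := by
      rw [← Submodule.coe_inner, Matrix.one_apply]
      exact orthonormal_iff_ite.1 b.orthonormal i j
    have hbj : ⟪v, (b j : F)⟫_ℝ = 0 := by
      rw [real_inner_comm]; exact inner_orthogonal_span_eq_zero v _
    simp [Matrix.gram_apply, inner_add_left, inner_add_right, inner_smul_left, inner_smul_right,
      inner_orthogonal_span_eq_zero, hb, hbj, hv, Matrix.mul_apply, mul_comm]
  rw [h2, Matrix.det_one_add_replicateCol_mul_replicateRow] at h1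
  have h3 : (fun i => ℓ (b i)) ⬝ᵥ (fun i => ℓ (b i)) = ‖ℓ‖ ^ 2 := by
    obtain ⟨a, rfl⟩ := (InnerProductSpace.toDual ℝ (ℝ ∙ v)ᗮ).surjective ℓ
    rw [LinearIsometryEquiv.norm_map, ← b.sum_sq_norm_inner_left a]
    simp [dotProduct, sq]
  rw [h3] at h1
  exact_mod_cast h1

theorem hausdorffMeasure_graphMap_image_linear {v : F} (hv : ‖v‖ = 1) (ℓ : (ℝ ∙ v)ᗮ →L[ℝ] ℝ)
    (s : Set (ℝ ∙ v)ᗮ) :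
    μHE[Module.finrank ℝ (ℝ ∙ v)ᗮ] (graphMap v ℓ '' s) =
      ENNReal.ofReal (√(1 + ‖ℓ‖ ^ 2)) * volume s := by
  rw [← normDet_graphMap hv, ← LinearMap.euclideanHausdorffMeasure_image_eq_normDet_mul_volume]
  rfl

/-- Turns an additive error δ in the slope into a factor 1 + δ in the area density. After squaring,
the gap is at least 2δ(1 - b + b²) + δ²b². -/
theorem sqrt_one_add_sq_le {a b δ : ℝ} (ha : 0 ≤ a) (hδ : 0 ≤ δ) (h : a ≤ b + δ) :
    √(1 + a ^ 2) ≤ (1 + δ) * √(1 + b ^ 2) := by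
  have h1 : 1 ≤ √(1 + b ^ 2) := by
    rw [Real.one_le_sqrt]; nlinarith
  have h2 : b ≤ √(1 + b ^ 2) := Real.le_sqrt_of_sq_le (by linarith)
  have h3 : √(1 + b ^ 2) ^ 2 = 1 + b ^ 2 := Real.sq_sqrt (by positivity)
  rw [Real.sqrt_le_iff]
  refine ⟨by positivity, ?_⟩
  have : a ^ 2 ≤ (b + δ) ^ 2 := by gcongr
  have h4 : 0 ≤ δ * (1 - b + b ^ 2) := mul_nonneg hδ (by nlinarith [sq_nonneg (b - 1)])
  rw [mul_pow, h3]
  nlinarith [mul_nonneg (mul_nonneg hδ hδ) (sq_nonneg b)]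

omit [MeasurableSpace F] [BorelSpace F] in
-- The almost everywhere estimate for approximately linear maps concerns maps from `V` to itself.
-- Multiplying by a unit vector `e` makes φ such a map and preserves norms; this is why `V` must be
-- nontrivial.
theorem ae_norm_fderiv_sub_le {V : Type*} [NormedAddCommGroup V] [InnerProductSpace ℝ V]
    [FiniteDimensional ℝ V] [MeasurableSpace V] [BorelSpace V] [Nontrivial V] {φ : V → ℝ}
    {A : V →L[ℝ] ℝ} {δ : ℝ≥0} {s : Set V} (hf : ApproximatesLinearOn φ A s δ)
    (hs : MeasurableSet s) (hd : ∀ x ∈ s, DifferentiableAt ℝ φ x) :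
    ∀ᵐ x ∂(volume : Measure V).restrict s, ‖fderiv ℝ φ x - A‖₊ ≤ δ := by
  obtain ⟨e, he⟩ := exists_norm_eq V zero_le_one
  have h1 : ApproximatesLinearOn (fun x => φ x • e) (A.smulRight e) s δ := by
    intro x hx y hy
    have : φ x • e - φ y • e - (A.smulRight e) (x - y) = (φ x - φ y - A (x - y)) • e := by
      simp [sub_smul]
    rw [this, norm_smul, he, mul_one]
    exact hf x hx y hy
  have := h1.norm_fderiv_sub_le (volume : Measure V) hs (fun x => (fderiv ℝ φ x).smulRight e)
    fun x hx => ((hd x hx).hasFDerivAt.smul_const e).hasFDerivWithinAt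
  filter_upwards [this] with x hx
  have h2 : (fderiv ℝ φ x).smulRight e - A.smulRight e = (fderiv ℝ φ x - A).smulRight e := by
    ext z; simp [sub_smul]
  rw [h2] at hx
  have h3 : ‖(fderiv ℝ φ x - A).smulRight e‖ ≤ δ := hx
  rw [ContinuousLinearMap.norm_smulRight_apply, he, mul_one] at h3
  exact h3

/-- The factor between the area of a graph with height `φ` and the volume of its base. -/
def graphDensity {V : Type*} [NormedAddCommGroup V] [NormedSpace ℝ V] (φ : V → ℝ) (y : V) : ℝ :=
  √(1 + ‖fderiv ℝ φ y‖ ^ 2)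

theorem one_le_graphDensity {V : Type*} [NormedAddCommGroup V] [NormedSpace ℝ V] (φ : V → ℝ)
    (y : V) : 1 ≤ graphDensity φ y := by
  rw [graphDensity, Real.one_le_sqrt]; nlinarith [norm_nonneg (fderiv ℝ φ y)]

theorem measurable_graphDensity {V : Type*} [NormedAddCommGroup V] [NormedSpace ℝ V]
    [MeasurableSpace V] [BorelSpace V] (φ : V → ℝ) : Measurable (graphDensity φ) :=
  ((measurable_fderiv ℝ φ).norm.pow_const 2 |>.const_add 1).sqrt

omit [FiniteDimensional ℝ F] [MeasurableSpace F] [BorelSpace F] in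
theorem graphMap_lipschitz {v : F} (hv : ‖v‖ = 1) {φ : (ℝ ∙ v)ᗮ → ℝ} {K : ℝ≥0}
    (hφ : LipschitzWith K φ) : LipschitzWith (1 + K) (graphMap v φ) := by
  refine LipschitzWith.of_dist_le_mul fun x y => ?_
  rw [dist_eq_norm, dist_eq_norm, graphMap_sub]
  refine (norm_add_le _ _).trans ?_
  have := hφ.dist_le_mul x y
  rw [dist_eq_norm, dist_eq_norm] at this
  rw [norm_smul, hv, mul_one, Submodule.coe_norm, NNReal.coe_add, NNReal.coe_one, add_mul, one_mul]
  gcongr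
  exact this

omit [MeasurableSpace F] [BorelSpace F] in
theorem graphMap_isClosedEmbedding {v : F} (hv : ‖v‖ = 1) {φ : (ℝ ∙ v)ᗮ → ℝ} {K : ℝ≥0}
    (hφ : LipschitzWith K φ) : IsClosedEmbedding (graphMap v φ) := by
  have : AntilipschitzWith 1 (graphMap v φ) := AntilipschitzWith.of_le_mul_dist fun x y => by
    simpa [dist_eq_norm] using norm_sub_le_norm_graphMap_sub hv φ x y
  exact this.isClosedEmbedding (graphMap_lipschitz hv hφ).uniformContinuous

/-- Comparison with the flat graph: by the Lipschitz bound the area grows at most by the factor (1 +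
K)^d. -/
theorem hausdorffMeasure_graphMap_image_null {v : F} (hv : ‖v‖ = 1) {φ : (ℝ ∙ v)ᗮ → ℝ} {K : ℝ≥0}
    (hφ : LipschitzWith K φ) {s : Set (ℝ ∙ v)ᗮ} (hs : volume s = 0) :
    μHE[Module.finrank ℝ (ℝ ∙ v)ᗮ] (graphMap v φ '' s) = 0 := by
  have h := hausdorffMeasure_graphMap_image_le hv (φ := φ) (ψ := (0 : (ℝ ∙ v)ᗮ →L[ℝ] ℝ)) (δ := K)
    (s := s) (fun x _ y _ => by
      have := hφ.dist_le_mul x y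
      rw [dist_eq_norm, dist_eq_norm, Real.norm_eq_abs] at this
      simpa only [zero_apply, sub_zero] using this) (Module.finrank ℝ (ℝ ∙ v)ᗮ)
  rw [hausdorffMeasure_graphMap_image_linear hv, hs] at h
  simpa using h

theorem le_of_forall_le_one_add_pow_mul {a b : ℝ≥0∞} (k : ℕ)
    (h : ∀ δ : ℝ≥0, 0 < δ → a ≤ ((1 + δ : ℝ≥0) : ℝ≥0∞) ^ k * b) : a ≤ b := by
  have h1 : Tendsto (fun δ : ℝ≥0 => ((1 + δ : ℝ≥0) : ℝ≥0∞) ^ k * b) (𝓝[>] 0) (𝓝 b) := by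
    have h2 : Tendsto (fun δ : ℝ≥0 => (((1 + δ) ^ k : ℝ≥0) : ℝ≥0∞)) (𝓝[>] 0) (𝓝 ((1 : ℝ≥0) : ℝ≥0∞)) := by
      refine ENNReal.tendsto_coe.2 (Tendsto.mono_left ?_ nhdsWithin_le_nhds)
      have : Continuous fun δ : ℝ≥0 => (1 + δ) ^ k := by fun_prop
      simpa using this.tendsto 0
    have h3 := ENNReal.Tendsto.mul_const (b := b) h2 (Or.inl (by simp))
    simpa using h3
  exact ge_of_tendsto h1 (eventually_nhdsWithin_of_forall fun δ hδ => h δ hδ)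

/-- The **area formula** for Lipschitz graphs. -/
theorem hausdorffMeasure_graphMap_image {v : F} (hv : ‖v‖ = 1) [Nontrivial (ℝ ∙ v)ᗮ]
    {φ : (ℝ ∙ v)ᗮ → ℝ} {K : ℝ≥0} (hφ : LipschitzWith K φ) {s : Set (ℝ ∙ v)ᗮ}
    (hs : MeasurableSet s) :
    μHE[Module.finrank ℝ (ℝ ∙ v)ᗮ] (graphMap v φ '' s) =
      ∫⁻ y in s, ENNReal.ofReal (graphDensity φ y) := by
  have hemb := (graphMap_isClosedEmbedding hv hφ).measurableEmbedding
  set d := Module.finrank ℝ (ℝ ∙ v)ᗮ with hd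
  set μ : Measure (ℝ ∙ v)ᗮ := (μHE[d] : Measure F).comap (graphMap v φ) with hμ
  have hμa : ∀ t, μ t = μHE[d] (graphMap v φ '' t) := fun t => hemb.comap_apply _ _
  -- Together with Rademacher's theorem this allows the points where φ is not differentiable to be
  -- discarded on both sides.
  have hac : μ ≪ volume := by
    intro t ht
    rw [hμa, hausdorffMeasure_graphMap_image_null hv hφ ht]
  set S := s ∩ {y | DifferentiableAt ℝ φ y} with hS
  have hSm : MeasurableSet S := hs.inter (measurableSet_of_differentiableAt ℝ φ)
  have hSs : S =ᵐ[volume] s := by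
    filter_upwards [hφ.ae_differentiableAt] with y hy
    exact propext ⟨fun h => h.1, fun h => ⟨h, hy⟩⟩
  -- Cut `S` into countably many pieces on which φ is linear up to δ. On each piece, passing to the
  -- linear graph costs (1 + δ)^d in Hausdorff measure, and passing from its constant density to
  -- that of φ costs one more factor; hence the exponent d + 1. Then δ tends to 0.
  have key : ∀ δ : ℝ≥0, 0 < δ →
      μ S ≤ ((1 + δ : ℝ≥0) : ℝ≥0∞) ^ (d + 1) * ∫⁻ y in S, ENNReal.ofReal (graphDensity φ y) ∧
      ∫⁻ y in S, ENNReal.ofReal (graphDensity φ y) ≤ ((1 + δ : ℝ≥0) : ℝ≥0∞) ^ (d + 1) * μ S := by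
    intro δ hδ
    obtain ⟨t, A, htd, htm, htS, hA, -⟩ :=
      exists_partition_approximatesLinearOn_of_hasFDerivWithinAt φ S (fderiv ℝ φ)
        (fun y hy => hy.2.hasFDerivAt.hasFDerivWithinAt) (fun _ => δ) (fun _ => hδ.ne')
    have hST : S = ⋃ n, S ∩ t n := by
      rw [← Set.inter_iUnion, Set.inter_eq_left.2 htS]
    have hm : ∀ n, MeasurableSet (S ∩ t n) := fun n => hSm.inter (htm n)
    have hdisj : Pairwise (Function.onFun Disjoint fun n => S ∩ t n) := fun i j hij =>
      (htd hij).mono Set.inter_subset_right Set.inter_subset_right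
    have e1 : μ S = ∑' n, μ (S ∩ t n) := by
      conv_lhs => rw [hST]
      exact measure_iUnion hdisj hm
    have e2 : ∫⁻ y in S, ENNReal.ofReal (graphDensity φ y)
        = ∑' n, ∫⁻ y in S ∩ t n, ENNReal.ofReal (graphDensity φ y) := by
      conv_lhs => rw [hST]
      exact lintegral_iUnion hm hdisj _
    have hlip : ∀ n, ∀ x ∈ S ∩ t n, ∀ y ∈ S ∩ t n,
        |(φ x - φ y) - (A n x - A n y)| ≤ δ * ‖x - y‖ := by
      intro n x hx y hy
      have := hA n x hx y hy
      rwa [map_sub, Real.norm_eq_abs] at this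
    have hconst : ∀ n, μHE[d] (graphMap v (A n) '' (S ∩ t n))
        = ∫⁻ y in S ∩ t n, ENNReal.ofReal (√(1 + ‖A n‖ ^ 2)) := by
      intro n
      rw [hausdorffMeasure_graphMap_image_linear hv, setLIntegral_const]
    have hae : ∀ n, ∀ᵐ y ∂(volume : Measure (ℝ ∙ v)ᗮ).restrict (S ∩ t n),
        ‖fderiv ℝ φ y - A n‖₊ ≤ δ := fun n =>
      ae_norm_fderiv_sub_le (hA n) (hm n) fun y hy => hy.1.2
    have hδc : ((1 + δ : ℝ≥0) : ℝ≥0∞) = ENNReal.ofReal (1 + δ) := by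
      rw [← NNReal.coe_one, ← NNReal.coe_add, ENNReal.ofReal_coe_nnreal]
    rw [e1, e2]
    constructor <;> rw [← ENNReal.tsum_mul_left] <;> refine ENNReal.tsum_le_tsum fun n => ?_
    · rw [hμa]
      refine (hausdorffMeasure_graphMap_image_le hv (hlip n) d).trans ?_
      rw [hconst, pow_succ _ d, mul_assoc,
        ← lintegral_const_mul' _ (fun y => ENNReal.ofReal (graphDensity φ y)) (by simp)]
      refine mul_le_mul_right (lintegral_mono_ae ?_) _
      filter_upwards [hae n] with y hy
      rw [hδc, ← ENNReal.ofReal_mul (by positivity)]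
      refine ENNReal.ofReal_le_ofReal (sqrt_one_add_sq_le (norm_nonneg _) δ.2 ?_)
      have h1 : ‖fderiv ℝ φ y - A n‖ ≤ δ := hy
      have h2 := norm_sub_norm_le (A n) (fderiv ℝ φ y)
      rw [norm_sub_rev] at h2
      linarith
    · rw [hμa]
      have := hausdorffMeasure_graphMap_image_le hv (φ := A n) (ψ := φ) (δ := δ) (s := S ∩ t n)
        (fun x hx y hy => by rw [abs_sub_comm]; exact hlip n x hx y hy) d
      rw [pow_succ' _ d, mul_assoc]
      refine le_trans ?_ (mul_le_mul_right this _)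
      rw [hconst, ← lintegral_const_mul' _ _ (by simp)]
      refine lintegral_mono_ae ?_
      filter_upwards [hae n] with y hy
      rw [hδc, ← ENNReal.ofReal_mul (by positivity)]
      refine ENNReal.ofReal_le_ofReal (sqrt_one_add_sq_le (norm_nonneg _) δ.2 ?_)
      have h1 : ‖fderiv ℝ φ y - A n‖ ≤ δ := hy
      have h2 := norm_sub_norm_le (fderiv ℝ φ y) (A n)
      linarith
  rw [← hμa, ← measure_congr (hac.ae_eq hSs), ← setLIntegral_congr hSs]
  exact le_antisymm (le_of_forall_le_one_add_pow_mul _ fun δ hδ => (key δ hδ).1)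
    (le_of_forall_le_one_add_pow_mul _ fun δ hδ => (key δ hδ).2)

/-- The area measure on a Lipschitz graph is the image of the weighted volume of the base. -/
theorem hausdorffMeasure_restrict_range_graphMap {v : F} (hv : ‖v‖ = 1) [Nontrivial (ℝ ∙ v)ᗮ]
    {φ : (ℝ ∙ v)ᗮ → ℝ} {K : ℝ≥0} (hφ : LipschitzWith K φ) :
    (μHE[Module.finrank ℝ (ℝ ∙ v)ᗮ] : Measure F).restrict (Set.range (graphMap v φ)) =
      (volume.withDensity fun y => ENNReal.ofReal (graphDensity φ y)).map (graphMap v φ) := by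
  have hemb := (graphMap_isClosedEmbedding hv hφ).measurableEmbedding
  ext s hs
  rw [Measure.restrict_apply hs, hemb.map_apply, withDensity_apply _ (hemb.measurable hs),
    ← hausdorffMeasure_graphMap_image hv hφ (hemb.measurable hs), Set.image_preimage_eq_inter_range]

end Graph

/-! ### Integration by parts for directional derivatives of Lipschitz functions. -/

section LineDeriv

variable {V : Type*} [NormedAddCommGroup V] [NormedSpace ℝ V] [FiniteDimensional ℝ V]
  [MeasurableSpace V] [BorelSpace V] {μ : Measure V} [μ.IsAddHaarMeasure]

theorem integral_lineDeriv_eq_zero {F : V → ℝ} {C : ℝ≥0} (hF : LipschitzWith C F)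
    (hc : HasCompactSupport F) (a : V) : ∫ y, lineDeriv ℝ F y a ∂μ = 0 := by
  have h := LipschitzWith.integral_lineDeriv_mul_eq (μ := μ) (LipschitzWith.const (1 : ℝ)) hF hc (-a)
  simpa [lineDeriv] using h.symm

omit [FiniteDimensional ℝ V] [MeasurableSpace V] [BorelSpace V] in
theorem lineDeriv_eq_zero_of_notMem_tsupport {F : V → ℝ} {x : V} (hx : x ∉ tsupport F) (a : V) :
    lineDeriv ℝ F x a = 0 := by
  have h : F =ᶠ[𝓝 x] fun _ => 0 := notMem_tsupport_iff_eventuallyEq.1 hx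
  rw [h.lineDeriv_eq]
  simp [lineDeriv]

theorem integrable_lineDeriv {F : V → ℝ} {C : ℝ≥0} (hF : LipschitzWith C F)
    (hc : HasCompactSupport F) (a : V) : Integrable (fun y => lineDeriv ℝ F y a) μ := by
  refine (integrableOn_iff_integrable_of_support_subset (s := tsupport F) ?_).1
    ((hF.locallyIntegrable_lineDeriv a).integrableOn_isCompact hc)
  intro x hx
  by_contra h
  exact hx (lineDeriv_eq_zero_of_notMem_tsupport h a)

theorem integrable_lineDeriv_mul_lineDeriv {F φ : V → ℝ} {C K : ℝ≥0} (hF : LipschitzWith C F)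
    (hc : HasCompactSupport F) (hφ : LipschitzWith K φ) (a b : V) :
    Integrable (fun y => lineDeriv ℝ F y a * lineDeriv ℝ φ y b) μ :=
  (integrable_lineDeriv hF hc a).mul_bdd (c := K * ‖b‖)
    (aestronglyMeasurable_lineDeriv hφ.continuous μ)
    (Eventually.of_forall fun _ => norm_lineDeriv_le_of_lipschitz ℝ hφ)

/-- The weak symmetry of mixed second derivatives: the two-dimensional minors of the derivative of
a pair of Lipschitz functions have vanishing integral. -/
theorem integral_lineDeriv_mul_lineDeriv_comm {F φ : V → ℝ} {C K : ℝ≥0} (hF : LipschitzWith C F)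
    (hc : HasCompactSupport F) (hφ : LipschitzWith K φ) (a b : V) :
    ∫ y, lineDeriv ℝ F y a * lineDeriv ℝ φ y b ∂μ =
      ∫ y, lineDeriv ℝ F y b * lineDeriv ℝ φ y a ∂μ := by
  -- The derivative of φ is only locally integrable, so it is cut off to `S`, outside of which F and
  -- F(· + t a) vanish for 0 < t ≤ 1.
  set S := Metric.cthickening ‖a‖ (tsupport F) with hS
  have hSc : IsCompact S := IsCompact.cthickening hc
  have hFS : ∀ x, x ∉ S → F x = 0 := fun x hx => by
    by_contra h
    exact hx (Metric.self_subset_cthickening _ (subset_tsupport _ h))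
  have hFS' : ∀ t : ℝ, 0 < t → t ≤ 1 → ∀ x, x ∉ S → F (x + t • a) = 0 := by
    intro t h0 h1 x hx
    by_contra h
    refine hx (Metric.mem_cthickening_of_dist_le _ _ _ _ (subset_tsupport _ h) ?_)
    rw [dist_eq_norm, sub_add_cancel_left, norm_neg, norm_smul, Real.norm_of_nonneg h0.le]
    exact mul_le_of_le_one_left (norm_nonneg _) h1
  have hg : Integrable (S.indicator fun y => lineDeriv ℝ φ y b) μ :=
    (integrable_indicator_iff hSc.measurableSet).2
      ((hφ.locallyIntegrable_lineDeriv b).integrableOn_isCompact hSc)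
  -- Two integrations by parts would need second derivatives. Instead the derivative along `a`
  -- becomes a difference quotient, of F with step t a on one side and of φ with step -t a on the
  -- other. For fixed t the two integrals agree by a translation and a single integration by parts
  -- along `b`; then t tends to 0.
  have h1 := hF.integral_inv_smul_sub_mul_tendsto_integral_lineDeriv_mul hg a
  have e1 : ∫ y, lineDeriv ℝ F y a * S.indicator (fun y => lineDeriv ℝ φ y b) y ∂μ
      = ∫ y, lineDeriv ℝ F y a * lineDeriv ℝ φ y b ∂μ := by
    congr 1; ext y
    by_cases hy : y ∈ S
    · rw [Set.indicator_of_mem hy]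
    · rw [lineDeriv_eq_zero_of_notMem_tsupport
        (fun h => hy (Metric.self_subset_cthickening _ h)), zero_mul, zero_mul]
  rw [e1] at h1
  have h2 := hφ.integral_inv_smul_sub_mul_tendsto_integral_lineDeriv_mul
    (integrable_lineDeriv (μ := μ) hF hc (-b)) (-a)
  have e2 : ∫ y, lineDeriv ℝ φ y (-a) * lineDeriv ℝ F y (-b) ∂μ
      = ∫ y, lineDeriv ℝ F y b * lineDeriv ℝ φ y a ∂μ := by
    simp only [lineDeriv_neg, neg_mul_neg, mul_comm]
  rw [e2] at h2
  refine tendsto_nhds_unique h1 (h2.congr' ?_)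
  filter_upwards [Ioc_mem_nhdsGT zero_lt_one] with t ht
  have e3 : ∀ y, (t⁻¹ • (F (y + t • a) - F y)) * S.indicator (fun y => lineDeriv ℝ φ y b) y
      = t⁻¹ * (lineDeriv ℝ φ y b * F (y + t • a) - lineDeriv ℝ φ y b * F y) := by
    intro y
    by_cases hy : y ∈ S
    · rw [Set.indicator_of_mem hy, smul_eq_mul]; ring
    · rw [Set.indicator_of_notMem hy, hFS y hy, hFS' t ht.1 ht.2 y hy]; ring
  have e4 : ∀ y, (t⁻¹ • (φ (y + t • -a) - φ y)) * lineDeriv ℝ F y (-b)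
      = t⁻¹ * (lineDeriv ℝ F y (-b) * φ (y + t • -a) - lineDeriv ℝ F y (-b) * φ y) := by
    intro y; rw [smul_eq_mul]; ring
  simp only [e3, e4, integral_const_mul]
  congr 1
  have hφt : LipschitzWith K fun y => φ (y + t • -a) :=
    LipschitzWith.of_dist_le_mul fun x y => by
      simpa using hφ.dist_le_mul (x + t • -a) (y + t • -a)
  have hFt : LipschitzWith C fun y => F (y + t • a) :=
    LipschitzWith.of_dist_le_mul fun x y => by
      simpa using hF.dist_le_mul (x + t • a) (y + t • a)
  have hct : HasCompactSupport fun y => F (y + t • a) :=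
    hc.comp_homeomorph (Homeomorph.addRight (t • a))
  have bddmul : ∀ {G : V → ℝ} {C' : ℝ≥0}, LipschitzWith C' G → HasCompactSupport G →
      Integrable (fun y => lineDeriv ℝ φ y b * G y) μ := fun hG hGc =>
    (hG.continuous.integrable_of_hasCompactSupport hGc).bdd_mul (c := K * ‖b‖)
      (aestronglyMeasurable_lineDeriv hφ.continuous μ)
      (Eventually.of_forall fun _ => norm_lineDeriv_le_of_lipschitz ℝ hφ)
  have contmul : ∀ {ψ : V → ℝ}, Continuous ψ →
      Integrable (fun y => lineDeriv ℝ F y (-b) * ψ y) μ := by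
    intro ψ hψ
    refine (integrableOn_iff_integrable_of_support_subset (s := tsupport F) ?_).1
      (IntegrableOn.mul_continuousOn (integrable_lineDeriv hF hc (-b)).integrableOn
        hψ.continuousOn hc)
    intro x hx
    by_contra h
    exact hx (by simp [lineDeriv_eq_zero_of_notMem_tsupport h])
  rw [integral_sub (contmul hφt.continuous) (contmul hφ.continuous),
    integral_sub (bddmul hFt hct) (bddmul hF hc)]
  congr 1
  · rw [← LipschitzWith.integral_lineDeriv_mul_eq hφt hF hc b,
      ← integral_add_right_eq_self
        (fun y => lineDeriv ℝ (fun y => φ (y + t • -a)) y b * F y) (t • a)]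
    congr 1; ext y
    congr 1
    simp only [lineDeriv]
    congr 1; ext s
    congr 1; rw [smul_neg]; abel
  · rw [LipschitzWith.integral_lineDeriv_mul_eq hφ hF hc b]

end LineDeriv

/-! ### Domains below a Lipschitz graph: boundary, normal, area and the local Stokes theorem. -/

section GraphDomain

variable {n : ℕ}

/-- The upward normal `v - ∇φ` of the graph of `φ` over the point `y`. -/
def graphNormal (v : E n) (φ : (ℝ ∙ v)ᗮ → ℝ) (y : (ℝ ∙ v)ᗮ) : E n :=
  v - ((InnerProductSpace.toDual ℝ (ℝ ∙ v)ᗮ).symm (fderiv ℝ φ y) : (ℝ ∙ v)ᗮ)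

theorem orthogonalProjection_add_inner_smul {v : E n} (hv : ‖v‖ = 1) (x : E n) :
    ((ℝ ∙ v)ᗮ.orthogonalProjectionOnto x : E n) + ⟪v, x⟫_ℝ • v = x := by
  have h := Submodule.starProjection_add_starProjection_orthogonal (K := ℝ ∙ v) x
  rw [Submodule.starProjection_unit_singleton ℝ hv, add_comm] at h
  exact h

theorem orthogonalProjection_graphMap (v : E n) (φ : (ℝ ∙ v)ᗮ → ℝ) (y : (ℝ ∙ v)ᗮ) :
    (ℝ ∙ v)ᗮ.orthogonalProjectionOnto (graphMap v φ y) = y := by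
  have : (ℝ ∙ v)ᗮ.orthogonalProjectionOnto v = 0 := by
    rw [Submodule.orthogonalProjectionOnto_eq_zero_iff]
    rw [Submodule.orthogonal_orthogonal]
    exact Submodule.mem_span_singleton_self v
  rw [graphMap, map_add, map_smul, this, smul_zero, add_zero,
    Submodule.orthogonalProjectionOnto_mem_subspace_eq_self]

theorem inner_graphMap {v : E n} (hv : ‖v‖ = 1) (φ : (ℝ ∙ v)ᗮ → ℝ) (y : (ℝ ∙ v)ᗮ) :
    ⟪v, graphMap v φ y⟫_ℝ = φ y := by
  rw [graphMap, inner_add_right, inner_smul_right, real_inner_self_eq_norm_sq, hv,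
    real_inner_comm, inner_orthogonal_span_eq_zero]
  simp

theorem mem_range_graphMap_iff {v : E n} (hv : ‖v‖ = 1) (φ : (ℝ ∙ v)ᗮ → ℝ) (x : E n) :
    x ∈ Set.range (graphMap v φ) ↔ ⟪v, x⟫_ℝ = φ ((ℝ ∙ v)ᗮ.orthogonalProjectionOnto x) := by
  constructor
  · rintro ⟨y, rfl⟩
    rw [inner_graphMap hv, orthogonalProjection_graphMap]
  · intro h
    refine ⟨(ℝ ∙ v)ᗮ.orthogonalProjectionOnto x, ?_⟩
    rw [graphMap, ← h, orthogonalProjection_add_inner_smul hv]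

theorem inner_graphNormal {v : E n} (φ : (ℝ ∙ v)ᗮ → ℝ) (y : (ℝ ∙ v)ᗮ) (w : E n) :
    ⟪w, graphNormal v φ y⟫_ℝ =
      ⟪v, w⟫_ℝ - fderiv ℝ φ y ((ℝ ∙ v)ᗮ.orthogonalProjectionOnto w) := by
  rw [graphNormal, inner_sub_right, real_inner_comm]
  congr 1
  rw [real_inner_comm, ← Submodule.inner_orthogonalProjectionOnto_eq_of_mem_left]
  rw [InnerProductSpace.toDual_symm_apply]

theorem norm_graphNormal {v : E n} (hv : ‖v‖ = 1) (φ : (ℝ ∙ v)ᗮ → ℝ) (y : (ℝ ∙ v)ᗮ) :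
    ‖graphNormal v φ y‖ = graphDensity φ y := by
  set w := (InnerProductSpace.toDual ℝ (ℝ ∙ v)ᗮ).symm (fderiv ℝ φ y) with hw
  have h := norm_coe_add_smul_sq hv (-w) 1
  have e : ((-w : (ℝ ∙ v)ᗮ) : E n) + (1 : ℝ) • v = graphNormal v φ y := by
    rw [graphNormal, ← hw, one_smul, Submodule.coe_neg, sub_eq_neg_add]
  rw [e, norm_neg, hw, LinearIsometryEquiv.norm_map] at h
  rw [graphDensity, ← Real.sqrt_sq (norm_nonneg (graphNormal v φ y)), h]
  congr 1
  ring

theorem measurable_graphNormal (v : E n) (φ : (ℝ ∙ v)ᗮ → ℝ) : Measurable (graphNormal v φ) := by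
  have h : Continuous fun ℓ : (ℝ ∙ v)ᗮ →L[ℝ] ℝ =>
      v - (((InnerProductSpace.toDual ℝ (ℝ ∙ v)ᗮ).symm ℓ : (ℝ ∙ v)ᗮ) : E n) := by
    fun_prop
  exact h.measurable.comp (measurable_fderiv ℝ φ)

/-- Inside `U`, the set `D` is the region strictly below the graph of the Lipschitz function `φ`
over `v^⊥`. -/
structure IsBelowGraph (D U : Set (E n)) (v : E n) (φ : (ℝ ∙ v)ᗮ → ℝ) (K : ℝ≥0) : Prop where
  norm_eq : ‖v‖ = 1
  lipschitz : LipschitzWith K φ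
  isOpen : IsOpen U
  mem_iff : ∀ x ∈ U, x ∈ D ↔ ⟪v, x⟫_ℝ < φ ((ℝ ∙ v)ᗮ.orthogonalProjectionOnto x)

variable {D U : Set (E n)} {v : E n} {φ : (ℝ ∙ v)ᗮ → ℝ} {K : ℝ≥0}

theorem IsBelowGraph.mono (h : IsBelowGraph D U v φ K) {U' : Set (E n)} (hU' : IsOpen U')
    (hsub : U' ⊆ U) : IsBelowGraph D U' v φ K :=
  ⟨h.norm_eq, h.lipschitz, hU', fun x hx => h.mem_iff x (hsub hx)⟩

/-- Let `H` be the height above the graph, so that `D` is {H < 0} in `U`. Where H ≠ 0, continuity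
places a whole neighbourhood in `D` or in its complement. Where H = 0, small steps along -v and v
lead into and out of `D`. -/
theorem IsBelowGraph.mem_frontier_iff (h : IsBelowGraph D U v φ K) {x : E n} (hx : x ∈ U) :
    x ∈ frontier D ↔ x ∈ Set.range (graphMap v φ) := by
  rw [mem_range_graphMap_iff h.norm_eq]
  set H : E n → ℝ := fun z => ⟪v, z⟫_ℝ - φ ((ℝ ∙ v)ᗮ.orthogonalProjectionOnto z) with hH
  have hHc : Continuous H := by
    have := h.lipschitz.continuous
    fun_prop
  have hUx : U ∈ 𝓝 x := h.isOpen.mem_nhds hx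
  have hmem : ∀ z ∈ U, z ∈ D ↔ H z < 0 := fun z hz => by rw [h.mem_iff z hz, hH, sub_neg]
  have hpr : (ℝ ∙ v)ᗮ.orthogonalProjectionOnto v = 0 := by
    rw [Submodule.orthogonalProjectionOnto_eq_zero_iff, Submodule.orthogonal_orthogonal]
    exact Submodule.mem_span_singleton_self v
  have hshift : ∀ s : ℝ, H (x + s • v) = H x + s := by
    intro s
    simp only [hH, map_add, map_smul, hpr, smul_zero, add_zero, inner_add_right, inner_smul_right,
      real_inner_self_eq_norm_sq, h.norm_eq]
    ring
  rw [← sub_eq_zero, show ⟪v, x⟫_ℝ - φ ((ℝ ∙ v)ᗮ.orthogonalProjectionOnto x) = H x from rfl]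
  constructor
  · intro hf
    rcases lt_trichotomy (H x) 0 with hlt | heq | hgt
    · exfalso
      have : D ∈ 𝓝 x := by
        filter_upwards [hUx, hHc.continuousAt.eventually_lt continuousAt_const hlt] with z h1 h2
        exact (hmem z h1).2 h2
      exact hf.2 (mem_interior_iff_mem_nhds.2 this)
    · exact heq
    · exfalso
      have : Dᶜ ∈ 𝓝 x := by
        filter_upwards [hUx, continuousAt_const.eventually_lt hHc.continuousAt hgt] with z h1 h2
        exact fun h3 => absurd ((hmem z h1).1 h3) (not_lt.2 h2.le)
      obtain ⟨z, hz1, hz2⟩ := mem_closure_iff_nhds.1 hf.1 _ this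
      exact hz1 hz2
  · intro h0
    have hlim : Tendsto (fun s : ℝ => x + s • v) (𝓝 0) (𝓝 x) := by
      have : Continuous fun s : ℝ => x + s • v := by fun_prop
      simpa using this.tendsto 0
    refine ⟨mem_closure_iff_nhds.2 fun W hW => ?_, fun hint => ?_⟩
    · obtain ⟨s, ⟨hs1, hs2⟩, hs3⟩ := (((hlim.mono_left nhdsWithin_le_nhds).eventually
        (inter_mem hW hUx)).and (self_mem_nhdsWithin (s := Set.Iio (0 : ℝ)))).exists
      exact ⟨_, hs1, (hmem _ hs2).2 (by rw [hshift, h0, zero_add]; exact hs3)⟩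
    · obtain ⟨s, ⟨hs1, hs2⟩, hs3⟩ := (((hlim.mono_left nhdsWithin_le_nhds).eventually
        (inter_mem (mem_interior_iff_mem_nhds.1 hint) hUx)).and
        (self_mem_nhdsWithin (s := Set.Ioi (0 : ℝ)))).exists
      have := (hmem _ hs2).1 hs1
      rw [hshift, h0, zero_add] at this
      exact absurd this (not_lt.2 (le_of_lt hs3))

/-- The derivative of the height `H` at the point is J⟨·, ν⟩ with J ≥ 1 the area density and ν the
normalised `graphNormal`. So the sign of `H` is that of ⟨z - x, ν⟩ once this exceeds ε|z - x| in
size; the linearisation error is kept below half of that. -/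
theorem IsBelowGraph.isOutwardNormal (h : IsBelowGraph D U v φ K) {y : (ℝ ∙ v)ᗮ}
    (hy : graphMap v φ y ∈ U) (hd : DifferentiableAt ℝ φ y) :
    IsOutwardNormal D (graphMap v φ y) ((graphDensity φ y)⁻¹ • graphNormal v φ y) := by
  set x := graphMap v φ y with hx
  set J := graphDensity φ y with hJ
  have hJ1 : 1 ≤ J := one_le_graphDensity φ y
  have hJ0 : 0 < J := by linarith
  refine ⟨by rw [norm_smul, norm_graphNormal h.norm_eq, Real.norm_of_nonneg (by positivity),
    inv_mul_cancel₀ hJ0.ne'], fun ε hε => ?_⟩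
  set pr := (ℝ ∙ v)ᗮ.orthogonalProjectionOnto with hpr
  set H : E n → ℝ := fun z => ⟪v, z⟫_ℝ - φ (pr z) with hH
  have hprx : pr x = y := orthogonalProjection_graphMap v φ y
  have hHx : H x = 0 := by
    rw [hH]; simp only [hprx]; rw [hx, inner_graphMap h.norm_eq, sub_self]
  have hder : HasFDerivAt H (innerSL ℝ v - (fderiv ℝ φ y).comp pr) x := by
    have h1 : HasFDerivAt φ (fderiv ℝ φ y) (pr x) := by rw [hprx]; exact hd.hasFDerivAt
    exact (innerSL ℝ v).hasFDerivAt.sub (h1.comp x pr.hasFDerivAt)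
  have hlo := hder.isLittleO.def (half_pos hε)
  filter_upwards [hlo, h.isOpen.mem_nhds hy] with z hz hzU
  rw [hHx, sub_zero] at hz
  have hin : (innerSL ℝ v - (fderiv ℝ φ y).comp pr) (z - x) = J * ⟪z - x, J⁻¹ • graphNormal v φ y⟫_ℝ := by
    rw [inner_smul_right, inner_graphNormal, mul_inv_cancel_left₀ hJ0.ne']
    rfl
  rw [hin, Real.norm_eq_abs, abs_le] at hz
  set p := ⟪z - x, J⁻¹ • graphNormal v φ y⟫_ℝ
  have hzx := norm_nonneg (z - x)
  have hzD : z ∈ D ↔ H z < 0 := by rw [h.mem_iff z hzU, hH, sub_neg]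
  rw [hzD]
  constructor
  · intro hp
    have : ε * ‖z - x‖ ≤ J * p := by nlinarith [mul_nonneg hε.le hzx]
    rw [not_lt]
    nlinarith [mul_nonneg hε.le hzx]
  · intro hp
    -- Membership in `D` needs strict negativity of `H`, which the slack ε/2 · |z - x| provides only
    -- for z ≠ x.
    by_cases h0 : ‖z - x‖ = 0
    · rw [h0] at hp hz
      nlinarith
    · have hpos : 0 < ‖z - x‖ := lt_of_le_of_ne hzx (Ne.symm h0)
      have : J * p ≤ -(ε * ‖z - x‖) := by nlinarith [mul_pos hε hpos]
      nlinarith [mul_pos hε hpos]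

theorem IsOutwardNormal.normalE_eq {x ν : E n} (h : IsOutwardNormal D x ν) : normalE D x = ν := by
  have hex : ∃ ν, IsOutwardNormal D x ν := ⟨ν, h⟩
  rw [normalE, dif_pos hex]
  exact hex.choose_spec.eq h

theorem norm_normalE_le (D : Set (E n)) (x : E n) : ‖normalE D x‖ ≤ 1 := by
  by_cases hex : ∃ ν, IsOutwardNormal D x ν
  · rw [normalE, dif_pos hex, hex.choose_spec.1]
  · rw [normalE, dif_neg hex, norm_zero]; exact zero_le_one

theorem finrank_orthogonal_span {v : E n} (hv : ‖v‖ = 1) :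
    Module.finrank ℝ (ℝ ∙ v)ᗮ = n - 1 := by
  have h := Submodule.finrank_add_finrank_orthogonal (ℝ ∙ v)
  rw [finrank_span_singleton (norm_ne_zero_iff.1 (by rw [hv]; exact one_ne_zero)),
    finrank_euclideanSpace_fin] at h
  omega

theorem nontrivial_orthogonal_span (hn : 2 ≤ n) {v : E n} (hv : ‖v‖ = 1) :
    Nontrivial (ℝ ∙ v)ᗮ := by
  apply Module.nontrivial_of_finrank_pos (R := ℝ)
  rw [finrank_orthogonal_span hv]; omega

theorem IsBelowGraph.measure_restrict (hn : 2 ≤ n) (h : IsBelowGraph D U v φ K) :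
    (μHE[n - 1] : Measure (E n)).restrict (frontier D ∩ U) =
      ((volume.withDensity fun y => ENNReal.ofReal (graphDensity φ y)).map
        (graphMap v φ)).restrict U := by
  have := nontrivial_orthogonal_span hn h.norm_eq
  have e : frontier D ∩ U = U ∩ Set.range (graphMap v φ) := by
    ext x
    rw [Set.inter_comm]
    exact and_congr_right fun hx => h.mem_frontier_iff hx
  rw [e, ← Measure.restrict_restrict h.isOpen.measurableSet,
    ← hausdorffMeasure_restrict_range_graphMap h.norm_eq h.lipschitz, finrank_orthogonal_span h.norm_eq]

/-- `normalE` is defined by choice; its measurability comes from this almost everywhere agreement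
with an explicit measurable expression, valid wherever φ is differentiable. -/
theorem IsBelowGraph.ae_normalE_eq (hn : 2 ≤ n) (h : IsBelowGraph D U v φ K) :
    ∀ᵐ x ∂(μHE[n - 1] : Measure (E n)).restrict (frontier D ∩ U), normalE D x =
      (graphDensity φ ((ℝ ∙ v)ᗮ.orthogonalProjectionOnto x))⁻¹ •
        graphNormal v φ ((ℝ ∙ v)ᗮ.orthogonalProjectionOnto x) := by
  have hemb := (graphMap_isClosedEmbedding h.norm_eq h.lipschitz).measurableEmbedding
  rw [h.measure_restrict hn, ae_restrict_iff' h.isOpen.measurableSet, hemb.ae_map_iff]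
  filter_upwards [(withDensity_absolutelyContinuous _ _).ae_le h.lipschitz.ae_differentiableAt]
    with y hd hy
  rw [(h.isOutwardNormal hy hd).normalE_eq, orthogonalProjection_graphMap]

theorem IsBelowGraph.aestronglyMeasurable_normalE (hn : 2 ≤ n) (h : IsBelowGraph D U v φ K) :
    AEStronglyMeasurable (normalE D) ((μHE[n - 1] : Measure (E n)).restrict (frontier D ∩ U)) := by
  have hm : Measurable fun x : E n => (graphDensity φ ((ℝ ∙ v)ᗮ.orthogonalProjectionOnto x))⁻¹ •
        graphNormal v φ ((ℝ ∙ v)ᗮ.orthogonalProjectionOnto x) := by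
    have hp : Measurable fun x : E n => (ℝ ∙ v)ᗮ.orthogonalProjectionOnto x :=
      (ContinuousLinearMap.continuous _).measurable
    exact ((measurable_graphDensity φ).comp hp).inv.smul ((measurable_graphNormal v φ).comp hp)
  exact hm.aestronglyMeasurable.congr ((h.ae_normalE_eq hn).mono fun _ hx => hx.symm)

theorem IsBelowGraph.setIntegral_frontier (hn : 2 ≤ n) (h : IsBelowGraph D U v φ K)
    {g : E n → ℝ} (hg : ∀ x, x ∉ U → g x = 0) :
    ∫ x in frontier D, g x ∂μHE[n - 1] =
      ∫ y, graphDensity φ y * g (graphMap v φ y) := by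
  have hemb := (graphMap_isClosedEmbedding h.norm_eq h.lipschitz).measurableEmbedding
  rw [setIntegral_eq_of_subset_of_forall_sdiff_eq_zero isClosed_frontier.measurableSet
    (Set.inter_subset_left (t := U)) (fun x hx => hg x fun hU => hx.2 ⟨hx.1, hU⟩),
    h.measure_restrict hn, setIntegral_eq_integral_of_forall_compl_eq_zero hg, hemb.integral_map,
    integral_withDensity_eq_integral_toReal_smul
      (measurable_graphDensity φ).ennreal_ofReal (Eventually.of_forall fun _ => ENNReal.ofReal_lt_top)]
  congr 1; ext y
  rw [ENNReal.toReal_ofReal (zero_le_one.trans (one_le_graphDensity φ y)), smul_eq_mul]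

/-- The base of the piece is bounded because projection to the hyperplane does not increase
distances, and comparison with the flat graph bounds its area by (1 + K)^d times the volume of the
base. -/
theorem IsBelowGraph.measure_frontier_inter_lt_top (h : IsBelowGraph D U v φ K)
    (hU : Bornology.IsBounded U) : (μHE[n - 1] : Measure (E n)) (frontier D ∩ U) < ∞ := by
  have hemb := (graphMap_isClosedEmbedding h.norm_eq h.lipschitz)
  have e : frontier D ∩ U ⊆ graphMap v φ '' (graphMap v φ ⁻¹' U) := by
    rintro x ⟨hx, hxU⟩
    obtain ⟨y, rfl⟩ := (h.mem_frontier_iff hxU).1 hx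
    exact ⟨y, hxU, rfl⟩
  have hb : Bornology.IsBounded (graphMap v φ ⁻¹' U) := by
    have : AntilipschitzWith 1 (graphMap v φ) := AntilipschitzWith.of_le_mul_dist fun x y => by
      simpa [dist_eq_norm] using norm_sub_le_norm_graphMap_sub h.norm_eq φ x y
    exact this.isBounded_preimage hU
  refine (measure_mono e).trans_lt ?_
  have h1 := hausdorffMeasure_graphMap_image_le h.norm_eq (φ := φ)
    (ψ := (0 : (ℝ ∙ v)ᗮ →L[ℝ] ℝ)) (δ := K) (s := graphMap v φ ⁻¹' U) (fun x _ y _ => by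
      have := h.lipschitz.dist_le_mul x y
      rw [dist_eq_norm, dist_eq_norm, Real.norm_eq_abs] at this
      simpa only [zero_apply, sub_zero] using this) (Module.finrank ℝ (ℝ ∙ v)ᗮ)
  rw [hausdorffMeasure_graphMap_image_linear h.norm_eq, finrank_orthogonal_span h.norm_eq] at h1
  refine h1.trans_lt (ENNReal.mul_lt_top (by simp) (ENNReal.mul_lt_top (by simp) hb.measure_lt_top))

/-- **Stokes' theorem** for a tangential derivative of a function supported in a graph chart. -/
theorem IsBelowGraph.integral_tangential_eq_zero (hn : 2 ≤ n) (h : IsBelowGraph D U v φ K)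
    {f : E n → ℝ} (hf : ContDiff ℝ 1 f) (hc : HasCompactSupport f) (hfU : tsupport f ⊆ U)
    (u w : E n) :
    ∫ x in frontier D, (fderiv ℝ f x u * ⟪w, normalE D x⟫_ℝ
      - fderiv ℝ f x w * ⟪u, normalE D x⟫_ℝ) ∂μHE[n - 1] = 0 := by
  have hzero : ∀ x, x ∉ U → fderiv ℝ f x = 0 := fun x hx =>
    fderiv_of_notMem_tsupport ℝ fun hx' => hx (hfU hx')
  rw [h.setIntegral_frontier hn fun x hx => by simp [hzero x hx]]
  obtain ⟨C, hC⟩ := hf.lipschitzWith_of_hasCompactSupport hc one_ne_zero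
  set Φ := graphMap v φ with hΦ
  set F := f ∘ Φ with hF
  have hFL : LipschitzWith (C * (1 + K)) F := hC.comp (graphMap_lipschitz h.norm_eq h.lipschitz)
  have hFc : HasCompactSupport F :=
    hc.comp_isClosedEmbedding (graphMap_isClosedEmbedding h.norm_eq h.lipschitz)
  set a := (ℝ ∙ v)ᗮ.orthogonalProjectionOnto u with ha
  set b := (ℝ ∙ v)ᗮ.orthogonalProjectionOnto w with hb
  set s := ⟪v, u⟫_ℝ with hs
  set t := ⟪v, w⟫_ℝ with ht
  -- Split u = a + s v and w = b + t v. The area density cancels the normalisation of the normal v -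
  -- ∇φ, the terms with s t cancel, and the chain rule for F = f ∘ Φ leaves a 2 × 2 minor of the
  -- derivatives of F and φ plus first derivatives of F. Both parts integrate to zero.
  have key : ∀ᵐ y, graphDensity φ y * (fderiv ℝ f (Φ y) u * ⟪w, normalE D (Φ y)⟫_ℝ
      - fderiv ℝ f (Φ y) w * ⟪u, normalE D (Φ y)⟫_ℝ) =
      (lineDeriv ℝ F y b * lineDeriv ℝ φ y a - lineDeriv ℝ F y a * lineDeriv ℝ φ y b)
        + (t * lineDeriv ℝ F y a - s * lineDeriv ℝ F y b) := by
    filter_upwards [h.lipschitz.ae_differentiableAt] with y hd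
    have hΦd : HasFDerivAt Φ ((ℝ ∙ v)ᗮ.subtypeL + (fderiv ℝ φ y).smulRight v) y :=
      (ℝ ∙ v)ᗮ.subtypeL.hasFDerivAt.add (hd.hasFDerivAt.smul_const v)
    have hFd : HasFDerivAt F _ y :=
      HasFDerivAt.comp y ((hf.differentiable one_ne_zero).differentiableAt.hasFDerivAt) hΦd
    have e1 : ∀ z, lineDeriv ℝ F y z = fderiv ℝ f (Φ y) z + fderiv ℝ φ y z * fderiv ℝ f (Φ y) v := by
      intro z
      rw [hFd.differentiableAt.lineDeriv_eq_fderiv, hFd.fderiv]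
      simp
    have e2 : ∀ z, lineDeriv ℝ φ y z = fderiv ℝ φ y z := fun z => hd.lineDeriv_eq_fderiv
    have e3 : fderiv ℝ f (Φ y) u = fderiv ℝ f (Φ y) a + s * fderiv ℝ f (Φ y) v := by
      conv_lhs => rw [← orthogonalProjection_add_inner_smul h.norm_eq u]
      rw [map_add, map_smul, smul_eq_mul]
    have e4 : fderiv ℝ f (Φ y) w = fderiv ℝ f (Φ y) b + t * fderiv ℝ f (Φ y) v := by
      conv_lhs => rw [← orthogonalProjection_add_inner_smul h.norm_eq w]
      rw [map_add, map_smul, smul_eq_mul]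
    by_cases hy : Φ y ∈ U
    · have hJ : graphDensity φ y ≠ 0 := (zero_lt_one.trans_le (one_le_graphDensity φ y)).ne'
      have e5 : ∀ z, ⟪z, normalE D (Φ y)⟫_ℝ = (graphDensity φ y)⁻¹ *
          (⟪v, z⟫_ℝ - fderiv ℝ φ y ((ℝ ∙ v)ᗮ.orthogonalProjectionOnto z)) := fun z => by
        rw [(h.isOutwardNormal hy hd).normalE_eq, inner_smul_right, inner_graphNormal]
      rw [e5, e5, e1, e1, e2, e2, e3, e4, ← ha, ← hb, ← hs, ← ht]
      field_simp
      ring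
    · rw [e1, e1]
      simp [hzero _ hy]
  have i1 := integrable_lineDeriv (μ := volume) hFL hFc a
  have i2 := integrable_lineDeriv (μ := volume) hFL hFc b
  have i3 := integrable_lineDeriv_mul_lineDeriv (μ := volume) hFL hFc h.lipschitz a b
  have i4 := integrable_lineDeriv_mul_lineDeriv (μ := volume) hFL hFc h.lipschitz b a
  have i5 : Integrable (fun y => lineDeriv ℝ F y b * lineDeriv ℝ φ y a
      - lineDeriv ℝ F y a * lineDeriv ℝ φ y b) := i4.sub i3
  have i6 : Integrable (fun y => t * lineDeriv ℝ F y a - s * lineDeriv ℝ F y b) :=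
    (i1.const_mul t).sub (i2.const_mul s)
  rw [integral_congr_ae key, integral_add i5 i6,
    integral_sub i4 i3, integral_sub (i1.const_mul t) (i2.const_mul s), integral_const_mul,
    integral_const_mul, integral_lineDeriv_eq_zero hFL hFc, integral_lineDeriv_eq_zero hFL hFc,
    integral_lineDeriv_mul_lineDeriv_comm hFL hFc h.lipschitz]
  simp

end GraphDomain

/-! ### Compact Lipschitz boundaries: finite area, integrability and Stokes' theorem. -/

section Stokes

variable {n : ℕ} {D : Set (E n)}

theorem HasLipschitzBoundary.exists_isBelowGraph (hD : HasLipschitzBoundary D) {O : Set (E n)}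
    (hO : IsOpen O) {p : E n} (hp : p ∈ frontier D) (hpO : p ∈ O) :
    ∃ (U : Set (E n)) (v : E n) (φ : (ℝ ∙ v)ᗮ → ℝ) (K : ℝ≥0),
      IsBelowGraph D U v φ K ∧ p ∈ U ∧ U ⊆ O ∧ Bornology.IsBounded U := by
  obtain ⟨v, K, φ, U, h1, h2, h3, h4, h5⟩ := hD p hp
  have h : IsBelowGraph D U v φ K := ⟨h1, h2, h3, h5⟩
  -- The unit ball makes the chart bounded, so that functions supported in it have compact support.
  exact ⟨U ∩ O ∩ Metric.ball p 1, v, φ, K,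
    h.mono ((h3.inter hO).inter Metric.isOpen_ball) fun x hx => hx.1.1,
    ⟨⟨h4, hpO⟩, Metric.mem_ball_self one_pos⟩, fun x hx => hx.1.2,
    Metric.isBounded_ball.subset Set.inter_subset_right⟩

theorem isCompact_frontier_of_isBounded (hb : Bornology.IsBounded D) : IsCompact (frontier D) :=
  Metric.isCompact_of_isClosed_isBounded isClosed_frontier
    (hb.closure.subset frontier_subset_closure)

/-- A compact Lipschitz boundary is covered by finitely many graph charts inside any given
neighbourhood of it. -/
theorem HasLipschitzBoundary.exists_finite_cover (hD : HasLipschitzBoundary D)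
    (hb : Bornology.IsBounded D) {O : Set (E n)} (hO : IsOpen O) (hDO : frontier D ⊆ O) :
    ∃ (t : Finset (E n)) (U : E n → Set (E n)), frontier D ⊆ ⋃ p ∈ t, U p ∧
      ∀ p ∈ t, U p ⊆ O ∧ Bornology.IsBounded (U p) ∧
        ∃ (v : E n) (φ : (ℝ ∙ v)ᗮ → ℝ) (K : ℝ≥0), IsBelowGraph D (U p) v φ K := by
  have h : ∀ p, ∃ U : Set (E n), p ∈ frontier D → p ∈ U ∧ U ⊆ O ∧ Bornology.IsBounded U ∧
      ∃ (v : E n) (φ : (ℝ ∙ v)ᗮ → ℝ) (K : ℝ≥0), IsBelowGraph D U v φ K := by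
    intro p
    by_cases hp : p ∈ frontier D
    · obtain ⟨U, v, φ, K, h1, h2, h3, h4⟩ := hD.exists_isBelowGraph hO hp (hDO hp)
      exact ⟨U, fun _ => ⟨h2, h3, h4, v, φ, K, h1⟩⟩
    · exact ⟨∅, fun h => absurd h hp⟩
  choose U hU using h
  obtain ⟨t, ht, htc⟩ := (isCompact_frontier_of_isBounded hb).elim_nhds_subcover U fun p hp => by
    obtain ⟨h1, -, -, v, φ, K, h⟩ := hU p hp
    exact h.isOpen.mem_nhds h1
  exact ⟨t, U, htc, fun p hp => (hU p (ht p hp)).2⟩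

theorem HasLipschitzBoundary.measure_frontier_lt_top (hD : HasLipschitzBoundary D)
    (hb : Bornology.IsBounded D) : (μHE[n - 1] : Measure (E n)) (frontier D) < ∞ := by
  obtain ⟨t, U, hc, ht⟩ := hD.exists_finite_cover hb isOpen_univ (Set.subset_univ _)
  have : frontier D ⊆ ⋃ p ∈ t, frontier D ∩ U p := by
    rw [← Set.inter_iUnion₂]
    exact Set.subset_inter subset_rfl hc
  refine (measure_mono this).trans_lt ((measure_biUnion_finset_le t _).trans_lt ?_)
  refine ENNReal.sum_lt_top.2 fun p hp => ?_
  obtain ⟨-, hbd, v, φ, K, h⟩ := ht p hp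
  exact h.measure_frontier_inter_lt_top hbd

theorem HasLipschitzBoundary.aestronglyMeasurable_normalE (hn : 2 ≤ n)
    (hD : HasLipschitzBoundary D) (hb : Bornology.IsBounded D) :
    AEStronglyMeasurable (normalE D) ((μHE[n - 1] : Measure (E n)).restrict (frontier D)) := by
  obtain ⟨t, U, hc, ht⟩ := hD.exists_finite_cover hb isOpen_univ (Set.subset_univ _)
  have e : frontier D = ⋃ p : t, frontier D ∩ U p := by
    rw [← Set.inter_iUnion]
    refine (Set.inter_eq_left.2 (hc.trans ?_)).symm
    exact Set.iUnion₂_subset fun p hp => Set.subset_iUnion (fun q : t => U q) ⟨p, hp⟩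
  rw [e, aestronglyMeasurable_iUnion_iff]
  rintro ⟨p, hp⟩
  obtain ⟨-, -, v, φ, K, h⟩ := ht p hp
  exact h.aestronglyMeasurable_normalE hn

/-- A continuous function times a component of the normal is integrable over a compact Lipschitz
boundary. -/
theorem HasLipschitzBoundary.integrableOn_mul_inner_normalE (hn : 2 ≤ n)
    (hD : HasLipschitzBoundary D) (hb : Bornology.IsBounded D) {c : E n → ℝ}
    (hc : ContinuousOn c (frontier D)) (w : E n) :
    IntegrableOn (fun x => c x * ⟪w, normalE D x⟫_ℝ) (frontier D) μHE[n - 1] := by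
  have hcomp := isCompact_frontier_of_isBounded hb
  have hfin : IsFiniteMeasure ((μHE[n - 1] : Measure (E n)).restrict (frontier D)) :=
    ⟨by rw [Measure.restrict_apply_univ]; exact hD.measure_frontier_lt_top hb⟩
  obtain ⟨C, hC⟩ := hcomp.exists_bound_of_continuousOn hc
  refine Integrable.of_bound (C := |C| * ‖w‖) ?_ ?_
  · exact (hc.aestronglyMeasurable isClosed_frontier.measurableSet).mul
      ((continuous_const.inner continuous_id : Continuous fun z : E n =>
        ⟪w, z⟫_ℝ).comp_aestronglyMeasurable (hD.aestronglyMeasurable_normalE hn hb))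
  · filter_upwards [ae_restrict_mem isClosed_frontier.measurableSet] with x hx
    rw [norm_mul]
    gcongr
    · exact (hC x hx).trans (le_abs_self C)
    · refine (norm_inner_le_norm _ _).trans ?_
      exact mul_le_of_le_one_right (norm_nonneg _) (norm_normalE_le D x)

/-- **Stokes' theorem** for tangential derivatives over a compact Lipschitz boundary. -/
theorem HasLipschitzBoundary.integral_tangential_eq_zero (hn : 2 ≤ n)
    (hD : HasLipschitzBoundary D) (hb : Bornology.IsBounded D) {O : Set (E n)} (hO : IsOpen O)
    (hDO : frontier D ⊆ O) {f : E n → ℝ} (hf : ContDiffOn ℝ 1 f O) (u w : E n) :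
    ∫ x in frontier D, (fderiv ℝ f x u * ⟪w, normalE D x⟫_ℝ
      - fderiv ℝ f x w * ⟪u, normalE D x⟫_ℝ) ∂μHE[n - 1] = 0 := by
  obtain ⟨t, U, hc, ht⟩ := hD.exists_finite_cover hb hO hDO
  have hUo : ∀ p ∈ t, IsOpen (U p) := fun p hp => by
    obtain ⟨-, -, v, φ, K, h⟩ := ht p hp
    exact h.isOpen
  -- The index `none` carries the complement of the boundary. Its partition function vanishes near
  -- the boundary, so the others sum to 1 in a neighbourhood of it and not merely on it; this is
  -- what makes the derivatives add up in `hsum`.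
  let W : Option t → Set (E n) := fun i => i.elim (frontier D)ᶜ fun p => U p
  obtain ⟨ρ, hρ⟩ := SmoothPartitionOfUnity.exists_isSubordinate (modelWithCornersSelf ℝ (E n))
    (s := Set.univ) isClosed_univ W
    (by
      rintro (_ | ⟨p, hp⟩)
      · exact isClosed_frontier.isOpen_compl
      · exact hUo p hp)
    (by
      intro x _
      rw [Set.mem_iUnion]
      by_cases hx : x ∈ frontier D
      · obtain ⟨p, hp, hxp⟩ := Set.mem_iUnion₂.1 (hc hx)
        exact ⟨some ⟨p, hp⟩, hxp⟩
      · exact ⟨none, hx⟩)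
  set F : t → E n → ℝ := fun p x => ρ (some p) x * f x with hF
  have hts : ∀ p : t, tsupport (F p) ⊆ U p := fun p =>
    (tsupport_mul_subset_left).trans (hρ (some p))
  have hF1 : ∀ p : t, ContDiff ℝ 1 (F p) := fun p => by
    refine contDiff_iff_contDiffAt.2 fun x => ?_
    by_cases hx : x ∈ tsupport (F p)
    swap
    · exact contDiffAt_const.congr_of_eventuallyEq (notMem_tsupport_iff_eventuallyEq.1 hx)
    refine ContDiffAt.mul ?_ (hf.contDiffAt (hO.mem_nhds ((ht p p.2).1 (hts p hx))))
    exact ((ρ (some p)).contMDiff.contDiff.of_le (by simp)).contDiffAt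
  have hFc : ∀ p : t, HasCompactSupport (F p) := fun p =>
    Metric.isCompact_of_isClosed_isBounded (isClosed_tsupport _)
      ((ht p p.2).2.1.subset (hts p))
  have hsum : ∀ x ∈ frontier D, fderiv ℝ f x = ∑ p, fderiv ℝ (F p) x := by
    intro x hx
    rw [← fderiv_fun_sum fun p _ => ((hF1 p).differentiable one_ne_zero).differentiableAt]
    refine Filter.EventuallyEq.fderiv_eq ?_
    have hnone : ∀ᶠ z in 𝓝 x, ρ none z = 0 :=
      notMem_tsupport_iff_eventuallyEq.1 fun h => (hρ none h) hx
    filter_upwards [hnone] with z hz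
    have h1 := ρ.sum_eq_one (Set.mem_univ z)
    rw [finsum_eq_sum_of_fintype, Fintype.sum_option, hz, zero_add] at h1
    rw [hF]
    simp only
    rw [← Finset.sum_mul, h1, one_mul]
  have hcongr : ∫ x in frontier D, (fderiv ℝ f x u * ⟪w, normalE D x⟫_ℝ
      - fderiv ℝ f x w * ⟪u, normalE D x⟫_ℝ) ∂μHE[n - 1] =
      ∫ x in frontier D, (∑ p, (fderiv ℝ (F p) x u * ⟪w, normalE D x⟫_ℝ
      - fderiv ℝ (F p) x w * ⟪u, normalE D x⟫_ℝ)) ∂μHE[n - 1] := by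
    refine setIntegral_congr_fun isClosed_frontier.measurableSet fun x hx => ?_
    simp only [hsum x hx, sum_apply, Finset.sum_mul, Finset.sum_sub_distrib]
  have hint : ∀ (p : t) (a b : E n),
      IntegrableOn (fun x => fderiv ℝ (F p) x a * ⟪b, normalE D x⟫_ℝ) (frontier D) μHE[n - 1] :=
    fun p a b => hD.integrableOn_mul_inner_normalE hn hb
      (((hF1 p).continuous_fderiv one_ne_zero).clm_apply continuous_const).continuousOn b
  have hint' : ∀ p : t, IntegrableOn (fun x => fderiv ℝ (F p) x u * ⟪w, normalE D x⟫_ℝ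
      - fderiv ℝ (F p) x w * ⟪u, normalE D x⟫_ℝ) (frontier D) μHE[n - 1] :=
    fun p => (hint p u w).sub (hint p w u)
  rw [hcongr, integral_finsetSum _ fun p _ => hint' p]
  refine Finset.sum_eq_zero fun p _ => ?_
  obtain ⟨-, -, v, φ, K, h⟩ := ht p p.2
  exact h.integral_tangential_eq_zero hn (hF1 p) (hFc p) (hts p) u w

end Stokes

/-! ### Smoothness of determinant and inverse. -/

section MatrixSmooth

variable {X : Type*} [NormedAddCommGroup X] [NormedSpace ℝ X] {ι : Type*} [Fintype ι]
  [DecidableEq ι] {k : WithTop ℕ∞} {M : X → Matrix ι ι ℝ} {x : X}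

theorem contDiffAt_matrix_det (hM : ∀ i j, ContDiffAt ℝ k (fun y => M y i j) x) :
    ContDiffAt ℝ k (fun y => (M y).det) x := by
  simp only [Matrix.det_apply, Units.smul_def, zsmul_eq_mul]
  exact ContDiffAt.sum fun σ _ => contDiffAt_const.mul (contDiffAt_prod fun i _ => hM _ _)

/-- Cramer's rule: the entries are cofactor determinants divided by a nonvanishing determinant. -/
theorem contDiffAt_matrix_inv (hM : ∀ i j, ContDiffAt ℝ k (fun y => M y i j) x)
    (hx : (M x).det ≠ 0) (i j : ι) : ContDiffAt ℝ k (fun y => (M y)⁻¹ i j) x := by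
  simp only [Matrix.inv_def, Ring.inverse_eq_inv', Matrix.smul_apply, smul_eq_mul,
    Matrix.adjugate_apply]
  refine ((contDiffAt_matrix_det hM).inv hx).mul (contDiffAt_matrix_det fun a b => ?_)
  by_cases h : a = j
  · subst h
    simp only [Matrix.updateRow_self]
    exact contDiffAt_const
  · simp only [Matrix.updateRow_ne h]
    exact hM a b

end MatrixSmooth

/-! ### Calculus of decay rates at infinity. -/

section Decay

variable {n : ℕ}

/-- `f = o(|x|^{-a})` at infinity. -/
def Decays (a : ℝ) (f : E n → ℝ) : Prop :=
  f =o[Bornology.cobounded (E n)] fun x => ‖x‖ ^ (-a)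

/-- `f = O(|x|^{-a})` at infinity. -/
def BoundedDecay (a : ℝ) (f : E n → ℝ) : Prop :=
  f =O[Bornology.cobounded (E n)] fun x => ‖x‖ ^ (-a)

variable {a b : ℝ} {f f' : E n → ℝ}

theorem eventually_lt_norm (R : ℝ) : ∀ᶠ x in Bornology.cobounded (E n), R < ‖x‖ :=
  tendsto_norm_cobounded_atTop.eventually_gt_atTop R

theorem rpow_mul_rpow_eventuallyEq (a b : ℝ) :
    (fun x : E n => ‖x‖ ^ (-a) * ‖x‖ ^ (-b)) =ᶠ[Bornology.cobounded (E n)]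
      fun x => ‖x‖ ^ (-(a + b)) := by
  filter_upwards [eventually_lt_norm 0] with x hx
  rw [← Real.rpow_add hx, neg_add]

theorem Decays.boundedDecay (h : Decays a f) : BoundedDecay a f := h.isBigO

theorem Decays.add (h : Decays a f) (h' : Decays a f') : Decays a fun x => f x + f' x :=
  Asymptotics.IsLittleO.add h h'

theorem Decays.sub (h : Decays a f) (h' : Decays a f') : Decays a fun x => f x - f' x :=
  Asymptotics.IsLittleO.sub h h'

theorem Decays.const_mul (h : Decays a f) (c : ℝ) : Decays a fun x => c * f x :=
  Asymptotics.IsLittleO.const_mul_left h c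

theorem Decays.sum {ι : Type*} {s : Finset ι} {F : ι → E n → ℝ} (h : ∀ i ∈ s, Decays a (F i)) :
    Decays a fun x => ∑ i ∈ s, F i x :=
  Asymptotics.IsLittleO.fun_sum h

theorem BoundedDecay.sum {ι : Type*} {s : Finset ι} {F : ι → E n → ℝ}
    (h : ∀ i ∈ s, BoundedDecay a (F i)) : BoundedDecay a fun x => ∑ i ∈ s, F i x :=
  Asymptotics.IsBigO.fun_sum h

theorem BoundedDecay.mul_decays (h : BoundedDecay a f) (h' : Decays b f') :
    Decays (a + b) fun x => f x * f' x :=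
  (Asymptotics.IsBigO.mul_isLittleO h h').congr' EventuallyEq.rfl (rpow_mul_rpow_eventuallyEq a b)

theorem Decays.mul_boundedDecay (h : Decays a f) (h' : BoundedDecay b f') :
    Decays (a + b) fun x => f x * f' x :=
  (Asymptotics.IsLittleO.mul_isBigO h h').congr' EventuallyEq.rfl (rpow_mul_rpow_eventuallyEq a b)

theorem Decays.congr (h : Decays a f) (e : f' =ᶠ[Bornology.cobounded (E n)] f) : Decays a f' :=
  Asymptotics.IsLittleO.congr' h e.symm EventuallyEq.rfl

theorem rpow_isBigO_rpow (hab : b ≤ a) :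
    (fun x : E n => ‖x‖ ^ (-a)) =O[Bornology.cobounded (E n)] fun x => ‖x‖ ^ (-b) := by
  refine Asymptotics.IsBigO.of_bound' ?_
  filter_upwards [eventually_lt_norm 1] with x hx
  rw [Real.norm_of_nonneg (by positivity), Real.norm_of_nonneg (by positivity)]
  exact Real.rpow_le_rpow_of_exponent_le hx.le (neg_le_neg hab)

theorem Decays.mono (h : Decays a f) (hab : b ≤ a) : Decays b f :=
  Asymptotics.IsLittleO.trans_isBigO h (rpow_isBigO_rpow hab)

theorem boundedDecay_zero_of_tendsto {c : ℝ} (h : Tendsto f (Bornology.cobounded (E n)) (𝓝 c)) :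
    BoundedDecay 0 f := by
  have := h.isBigO_one ℝ
  simpa [BoundedDecay] using this

theorem Decays.tendsto_zero (h : Decays a f) (ha : 0 ≤ a) :
    Tendsto f (Bornology.cobounded (E n)) (𝓝 0) := by
  have := h.mono ha
  simpa [Decays, Asymptotics.isLittleO_one_iff] using this

theorem boundedDecay_coord (i : Fin n) : BoundedDecay (-1) fun x : E n => x i := by
  refine Asymptotics.IsBigO.of_bound' (Eventually.of_forall fun x => ?_)
  rw [neg_neg, Real.rpow_one, norm_norm]
  exact PiLp.norm_apply_le x i

theorem IsLittleOk.decays {k : ℕ} {τ : ℝ} (h : IsLittleOk k τ f) (α : List (Fin n))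
    (hα : α.length ≤ k) : Decays (α.length + τ) (iterPderiv α f) := by
  refine (Asymptotics.isLittleO_iff_tendsto' ?_).2 ?_
  · filter_upwards [eventually_lt_norm 0] with x hx h0
    exact absurd h0 (Real.rpow_pos_of_pos hx _).ne'
  · rw [tendsto_zero_iff_abs_tendsto_zero]
    refine (h.2 α hα).congr' ?_
    filter_upwards [eventually_lt_norm 0] with x hx
    simp only [Function.comp_apply]
    rw [abs_div, abs_of_pos (Real.rpow_pos_of_pos hx _), Real.rpow_neg hx.le, div_inv_eq_mul,
      mul_comm]

theorem pderiv_sub_const (i : Fin n) (f : E n → ℝ) (c : ℝ) :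
    pderiv i (fun x => f x - c) = pderiv i f := by
  ext x
  simp only [pderiv, fderiv_sub_const]

/-- A smooth function of the metric coefficients is asymptotic to its value at the Euclidean
metric. -/
theorem decays_comp_sub {g : MetricField n} {τ : ℝ} (hτ : 0 ≤ τ)
    (hg : ∀ i j, Decays τ fun x => g x i j - (1 : Matrix (Fin n) (Fin n) ℝ) i j)
    {Ψ : (Fin n → Fin n → ℝ) → ℝ}
    (hΨ : DifferentiableAt ℝ Ψ (1 : Matrix (Fin n) (Fin n) ℝ)) :
    Decays τ fun x => Ψ (g x) - Ψ (1 : Matrix (Fin n) (Fin n) ℝ) := by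
  have hlim : Tendsto (fun x => (g x : Fin n → Fin n → ℝ)) (Bornology.cobounded (E n))
      (𝓝 ((1 : Matrix (Fin n) (Fin n) ℝ) : Fin n → Fin n → ℝ)) := by
    refine tendsto_pi_nhds.2 fun i => tendsto_pi_nhds.2 fun j => ?_
    exact tendsto_sub_nhds_zero_iff.1 ((hg i j).tendsto_zero hτ)
  -- Differentiability at the Euclidean metric alone gives Ψ(g) - Ψ(1) = O(g - 1).
  have h1 := hΨ.hasFDerivAt.isBigO_sub.comp_tendsto hlim
  refine Asymptotics.IsBigO.trans_isLittleO h1 ?_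
  exact Asymptotics.isLittleO_pi.2 fun i => Asymptotics.isLittleO_pi.2 fun j => hg i j

end Decay

variable {n : ℕ}

/-! ### Rules for partial derivatives. -/

section PartialDerivatives

variable {x : E n} {f f' : E n → ℝ}

theorem pderiv_mul (i : Fin n) (hf : DifferentiableAt ℝ f x) (hf' : DifferentiableAt ℝ f' x) :
    pderiv i (fun y => f y * f' y) x = pderiv i f x * f' x + f x * pderiv i f' x := by
  simp only [pderiv, fderiv_fun_mul hf hf', add_apply, smul_apply, smul_eq_mul]
  ring

theorem pderiv_const_mul (i : Fin n) (hf : DifferentiableAt ℝ f x) (c : ℝ) :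
    pderiv i (fun y => c * f y) x = c * pderiv i f x := by
  simp only [pderiv, fderiv_const_mul hf, smul_apply, smul_eq_mul]

theorem pderiv_add (i : Fin n) (hf : DifferentiableAt ℝ f x) (hf' : DifferentiableAt ℝ f' x) :
    pderiv i (fun y => f y + f' y) x = pderiv i f x + pderiv i f' x := by
  simp only [pderiv, fderiv_fun_add hf hf', add_apply]

theorem pderiv_sub (i : Fin n) (hf : DifferentiableAt ℝ f x) (hf' : DifferentiableAt ℝ f' x) :
    pderiv i (fun y => f y - f' y) x = pderiv i f x - pderiv i f' x := by
  simp only [pderiv, fderiv_fun_sub hf hf', sub_apply]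

theorem pderiv_sum {ι : Type*} {s : Finset ι} {F : ι → E n → ℝ} (i : Fin n)
    (hF : ∀ a ∈ s, DifferentiableAt ℝ (F a) x) :
    pderiv i (fun y => ∑ a ∈ s, F a y) x = ∑ a ∈ s, pderiv i (F a) x := by
  simp only [pderiv, fderiv_fun_sum hF, sum_apply]

theorem pderiv_coord (i j : Fin n) (x : E n) :
    pderiv i (fun y : E n => y j) x = (1 : Matrix (Fin n) (Fin n) ℝ) i j := by
  have h : HasFDerivAt (fun y : E n => y j) (EuclideanSpace.proj j : E n →L[ℝ] ℝ) x :=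
    (EuclideanSpace.proj j : E n →L[ℝ] ℝ).hasFDerivAt
  rw [pderiv, h.fderiv]
  simp [Matrix.one_apply, eq_comm]

theorem contDiff_coord (i : Fin n) : ContDiff ℝ 1 fun x : E n => x i :=
  (EuclideanSpace.proj i : E n →L[ℝ] ℝ).contDiff

theorem contDiffOn_pderiv {k m : WithTop ℕ∞} {s : Set (E n)} (hf : ContDiffOn ℝ k f s)
    (hs : IsOpen s) (hm : m + 1 ≤ k) (i : Fin n) : ContDiffOn ℝ m (pderiv i f) s :=
  (hf.fderiv_of_isOpen hs hm).clm_apply contDiffOn_const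

theorem pderiv_pderiv_comm {s : Set (E n)} (hf : ContDiffOn ℝ 2 f s) (hs : IsOpen s) (hx : x ∈ s)
    (i j : Fin n) : pderiv i (pderiv j f) x = pderiv j (pderiv i f) x := by
  have h2 : ContDiffAt ℝ 2 f x := hf.contDiffAt (hs.mem_nhds hx)
  have hd : DifferentiableAt ℝ (fderiv ℝ f) x :=
    (h2.fderiv_right (m := 1) (by norm_num)).differentiableAt one_ne_zero
  have e : ∀ a b : Fin n, pderiv a (pderiv b f) x =
      fderiv ℝ (fderiv ℝ f) x (EuclideanSpace.single a 1) (EuclideanSpace.single b 1) := by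
    intro a b
    have := (hd.hasFDerivAt.clm_apply (hasFDerivAt_const (EuclideanSpace.single b (1 : ℝ)) x)).fderiv
    unfold pderiv
    rw [this]
    simp
  rw [e, e]
  exact (h2.isSymmSndFDerivAt (by simp)).eq _ _

end PartialDerivatives

/-! ### Linearized curvature, flux covectors and the superpotential. -/

/-- The twice lowered Christoffel symbols `g_{jl,i} + g_{il,j} - g_{ij,l}`. -/
def christoffelLow (g : MetricField n) (l i j : Fin n) (x : E n) : ℝ :=
  dg g j l i x + dg g i l j x - dg g i j l x

/-- The linearization at the Euclidean metric of the Ricci tensor. -/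
def linRicci (g : MetricField n) (i j : Fin n) (x : E n) : ℝ :=
  ∑ k, 1 / 2 * pderiv k (christoffelLow g k j i) x
    - ∑ k, 1 / 2 * pderiv j (christoffelLow g k k i) x

/-- The linearization at the Euclidean metric of the scalar curvature. -/
def linScalar (g : MetricField n) (x : E n) : ℝ := ∑ i, linRicci g i i x

/-- The linearization at the Euclidean metric of the Einstein tensor. -/
def linEinstein (g : MetricField n) (i j : Fin n) (x : E n) : ℝ :=
  linRicci g i j x - 1 / 2 * linScalar g x * (1 : Matrix (Fin n) (Fin n) ℝ) i j

/-- The Einstein tensor `Ric - ½ R_g g`. -/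
def einstein (g : MetricField n) (i j : Fin n) (x : E n) : ℝ :=
  ricci g i j x - 1 / 2 * scalarCurv g x * g x i j

/-- The coefficients `(det g)^{1/2} g^{jk}` relating `ν_g dσ_g` and `ν_e dσ_e`. -/
def conormalCoeff (g : MetricField n) (j k : Fin n) (x : E n) : ℝ :=
  √((g x).det) * (g x)⁻¹ j k

/-- The coefficients `b_k` of the Ricci flux `b_k ν_e^k dσ_e`. -/
def ricciFlux (g : MetricField n) (k : Fin n) (x : E n) : ℝ :=
  ∑ i, ∑ j, einstein g i j x * x i * conormalCoeff g j k x

/-- The covector `g_{ij,j} - g_{jj,i}`. -/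
def admFlux (g : MetricField n) (i : Fin n) (x : E n) : ℝ :=
  ∑ j, (dg g i j j x - dg g j j i x)

/-- The antisymmetric tensor whose divergence is the difference between the linearized Ricci flux
and a multiple of the ADM flux. -/
def superpotential (g : MetricField n) (j k : Fin n) (x : E n) : ℝ :=
  1 / 2 * (∑ i, x i * (dg g i k j x - dg g i j k x) + (x k * admFlux g j x - x j * admFlux g k x))

theorem superpotential_antisymm (g : MetricField n) (j k : Fin n) :
    superpotential g k j = fun x => -1 * superpotential g j k x := by
  ext x
  have : ∑ i, x i * (dg g i j k x - dg g i k j x) = -∑ i, x i * (dg g i k j x - dg g i j k x) := by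
    rw [← Finset.sum_neg_distrib]
    exact Finset.sum_congr rfl fun i _ => by ring
  rw [superpotential, superpotential, this]
  ring

/-- A metric that is `C²` and positive definite on `{R < |x|}`, and Euclidean up to `o₂(|x|^{-τ})`. -/
structure IsAsymptoticallyFlat (g : MetricField n) (R τ : ℝ) : Prop where
  nonneg : 0 ≤ τ
  posDef : ∀ x, R < ‖x‖ → (g x).PosDef
  contDiffOn : ∀ i j, ContDiffOn ℝ 2 (fun x => g x i j) {x | R < ‖x‖}
  decays : ∀ i j, Decays τ fun x => g x i j - (1 : Matrix (Fin n) (Fin n) ℝ) i j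
  decays_dg : ∀ i j k, Decays (τ + 1) (dg g i j k)
  decays_ddg : ∀ i j k l, Decays (τ + 2) (pderiv l (dg g i j k))

theorem exists_isAsymptoticallyFlat {g : MetricField n} {R₀ τ : ℝ} (hτ : 0 ≤ τ)
    (hpos : ∀ x : E n, R₀ < ‖x‖ → (g x).PosDef)
    (hdecay : ∀ i j : Fin n, IsLittleOk 2 τ
      (fun x => g x i j - (1 : Matrix (Fin n) (Fin n) ℝ) i j)) :
    ∃ R, IsAsymptoticallyFlat g R τ := by
  choose R hR using fun i j => (hdecay i j).1
  -- There are finitely many components, so a single radius serves them all.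
  obtain ⟨B, hB⟩ := (Set.finite_range fun p : Fin n × Fin n => R p.1 p.2).bddAbove
  have e : ∀ i j k, pderiv k (fun x => g x i j - (1 : Matrix (Fin n) (Fin n) ℝ) i j)
      = dg g i j k := fun i j k => pderiv_sub_const k _ _
  refine ⟨max R₀ B, hτ, fun x hx => hpos x (lt_of_le_of_lt (le_max_left _ _) hx), fun i j => ?_,
    fun i j => ?_, fun i j k => ?_, fun i j k l => ?_⟩
  · have h1 : ContDiffOn ℝ 2 (fun x => g x i j - (1 : Matrix (Fin n) (Fin n) ℝ) i j)
        {x | max R₀ B < ‖x‖} := (hR i j).mono fun _ hx =>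
      lt_of_le_of_lt ((hB (Set.mem_range_self (i, j))).trans (le_max_right _ _)) hx
    refine (h1.add (contDiffOn_const (c := (1 : Matrix (Fin n) (Fin n) ℝ) i j))).congr fun _ _ => ?_
    simp
  · have := (hdecay i j).decays [] (by simp)
    simpa [iterPderiv] using this
  · have := (hdecay i j).decays [k] (by simp)
    simp only [iterPderiv, e] at this
    exact this.mono (by simp [add_comm])
  · have := (hdecay i j).decays [l, k] (by simp)
    simp only [iterPderiv, e] at this
    refine this.mono ?_
    simp only [List.length_cons, List.length_nil]
    push_cast
    linarith

theorem isOpen_lt_norm (R : ℝ) : IsOpen {x : E n | R < ‖x‖} :=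
  isOpen_lt continuous_const continuous_norm

/-! ### Regularity of the geometric quantities in the end. -/

namespace IsAsymptoticallyFlat

variable {g : MetricField n} {R τ : ℝ}

theorem det_pos (h : IsAsymptoticallyFlat g R τ) {x : E n} (hx : R < ‖x‖) : 0 < (g x).det :=
  (h.posDef x hx).det_pos

theorem contDiffOn_dg (h : IsAsymptoticallyFlat g R τ) (i j k : Fin n) :
    ContDiffOn ℝ 1 (dg g i j k) {x | R < ‖x‖} :=
  contDiffOn_pderiv (h.contDiffOn i j) (isOpen_lt_norm R) (by norm_num) k

theorem contDiffOn_inv (h : IsAsymptoticallyFlat g R τ) (i j : Fin n) :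
    ContDiffOn ℝ 2 (fun x => (g x)⁻¹ i j) {x | R < ‖x‖} := fun _ hx =>
  (contDiffAt_matrix_inv
    (fun a b => (h.contDiffOn a b).contDiffAt ((isOpen_lt_norm R).mem_nhds hx))
    (h.det_pos hx).ne' i j).contDiffWithinAt

theorem contDiffOn_christoffelLow (h : IsAsymptoticallyFlat g R τ) (l i j : Fin n) :
    ContDiffOn ℝ 1 (christoffelLow g l i j) {x | R < ‖x‖} :=
  ((h.contDiffOn_dg _ _ _).add (h.contDiffOn_dg _ _ _)).sub (h.contDiffOn_dg _ _ _)

theorem contDiffOn_christoffel (h : IsAsymptoticallyFlat g R τ) (k i j : Fin n) :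
    ContDiffOn ℝ 1 (christoffel g k i j) {x | R < ‖x‖} :=
  contDiffOn_const.mul (ContDiffOn.sum fun l _ =>
    ((h.contDiffOn_inv k l).of_le (by norm_num)).mul (h.contDiffOn_christoffelLow l i j))

theorem contDiffOn_admFlux (h : IsAsymptoticallyFlat g R τ) (i : Fin n) :
    ContDiffOn ℝ 1 (admFlux g i) {x | R < ‖x‖} :=
  ContDiffOn.sum fun _ _ => (h.contDiffOn_dg _ _ _).sub (h.contDiffOn_dg _ _ _)

theorem contDiffOn_superpotential (h : IsAsymptoticallyFlat g R τ) (j k : Fin n) :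
    ContDiffOn ℝ 1 (superpotential g j k) {x | R < ‖x‖} :=
  contDiffOn_const.mul ((ContDiffOn.sum fun i _ => (contDiff_coord i).contDiffOn.mul
    ((h.contDiffOn_dg _ _ _).sub (h.contDiffOn_dg _ _ _))).add
    (((contDiff_coord k).contDiffOn.mul (h.contDiffOn_admFlux j)).sub
      ((contDiff_coord j).contDiffOn.mul (h.contDiffOn_admFlux k))))

theorem continuousOn_pderiv {f : E n → ℝ} (hf : ContDiffOn ℝ 1 f {x | R < ‖x‖}) (i : Fin n) :
    ContinuousOn (pderiv i f) {x | R < ‖x‖} :=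
  (contDiffOn_pderiv (m := 0) hf (isOpen_lt_norm R) (by norm_num) i).continuousOn

theorem continuousOn_ricci (h : IsAsymptoticallyFlat g R τ) (i j : Fin n) :
    ContinuousOn (ricci g i j) {x | R < ‖x‖} := by
  have hp : ∀ a k i j, ContinuousOn (pderiv a (christoffel g k i j)) {x | R < ‖x‖} :=
    fun a k i j => continuousOn_pderiv (h.contDiffOn_christoffel k i j) a
  have hc : ∀ k i j, ContinuousOn (christoffel g k i j) {x | R < ‖x‖} :=
    fun k i j => (h.contDiffOn_christoffel k i j).continuousOn
  unfold ricci
  exact (((continuousOn_finsetSum _ fun k _ => hp _ _ _ _).sub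
    (continuousOn_finsetSum _ fun k _ => hp _ _ _ _)).add
    (continuousOn_finsetSum _ fun k _ => continuousOn_finsetSum _ fun l _ =>
      (hc _ _ _).mul (hc _ _ _))).sub
    (continuousOn_finsetSum _ fun k _ => continuousOn_finsetSum _ fun l _ =>
      (hc _ _ _).mul (hc _ _ _))

theorem continuousOn_scalarCurv (h : IsAsymptoticallyFlat g R τ) :
    ContinuousOn (scalarCurv g) {x | R < ‖x‖} := by
  unfold scalarCurv
  exact continuousOn_finsetSum _ fun i _ => continuousOn_finsetSum _ fun j _ =>
    (h.contDiffOn_inv i j).continuousOn.mul (h.continuousOn_ricci i j)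

theorem continuousOn_conormalCoeff (h : IsAsymptoticallyFlat g R τ) (j k : Fin n) :
    ContinuousOn (conormalCoeff g j k) {x | R < ‖x‖} := by
  refine ContinuousOn.mul (ContinuousOn.sqrt fun x hx => ?_) (h.contDiffOn_inv j k).continuousOn
  exact (contDiffAt_matrix_det fun a b => (h.contDiffOn a b).contDiffAt
    ((isOpen_lt_norm R).mem_nhds hx)).continuousAt.continuousWithinAt

theorem continuousOn_ricciFlux (h : IsAsymptoticallyFlat g R τ) (k : Fin n) :
    ContinuousOn (ricciFlux g k) {x | R < ‖x‖} := by
  unfold ricciFlux einstein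
  exact continuousOn_finsetSum _ fun i _ => continuousOn_finsetSum _ fun j _ =>
    (((h.continuousOn_ricci i j).sub ((continuousOn_const.mul h.continuousOn_scalarCurv).mul
      (h.contDiffOn i j).continuousOn)).mul (contDiff_coord i).continuous.continuousOn).mul
      (h.continuousOn_conormalCoeff j k)

theorem continuousOn_admFlux (h : IsAsymptoticallyFlat g R τ) (k : Fin n) :
    ContinuousOn (admFlux g k) {x | R < ‖x‖} :=
  (h.contDiffOn_admFlux k).continuousOn

end IsAsymptoticallyFlat

/-! ### The exact identity for the linearized Einstein tensor. -/

/-- The algebraic identity behind the divergence structure of the linearized Einstein tensor,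
for the values `d i j k` of `g_{ij,k}` and `H i j k l` of `g_{ij,kl}` at a point `x`. -/
theorem einstein_superpotential_identity (d : Fin n → Fin n → Fin n → ℝ)
    (H : Fin n → Fin n → Fin n → Fin n → ℝ) (x m : Fin n → ℝ) (Rc : Fin n → Fin n → ℝ)
    (hd : ∀ i j k, d i j k = d j i k) (hH : ∀ i j k l, H i j k l = H j i k l)
    (hH' : ∀ i j k l, H i j k l = H i j l k)
    (hm : ∀ i, m i = ∑ k, (d i k k - d k k i))
    (hRc : ∀ i j, Rc i j = ∑ k, 1 / 2 * (H i k j k + H j k i k - H j i k k)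
      - ∑ k, 1 / 2 * (H i k k j + H k k i j - H k i k j)) (j : Fin n) :
    ∑ i, (Rc i j - 1 / 2 * (∑ a, Rc a a) * (1 : Matrix (Fin n) (Fin n) ℝ) i j) * x i =
      ∑ k, 1 / 2 * (∑ i, ((1 : Matrix (Fin n) (Fin n) ℝ) k i * (d i k j - d i j k)
          + x i * (H i k j k - H i j k k))
        + (((1 : Matrix (Fin n) (Fin n) ℝ) k k * m j + x k * ∑ a, (H j a a k - H a a j k))
          - ((1 : Matrix (Fin n) (Fin n) ℝ) k j * m k + x j * ∑ a, (H k a a k - H a a k k))))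
      - ((n : ℝ) - 2) / 2 * m j := by
  -- These are a_ij = g_{ik,jk}, b_ij = Δ g_ij and c_ij = ∂_i ∂_j tr g, in terms of which the
  -- linearized Ricci tensor is ½(a_ij + a_ji - b_ij - c_ij). The traces of b and c agree.
  set a : Fin n → Fin n → ℝ := fun i j => ∑ k, H i k j k with ha
  set b : Fin n → Fin n → ℝ := fun i j => ∑ k, H i j k k with hb
  set c : Fin n → Fin n → ℝ := fun i j => ∑ k, H k k i j with hc
  have hR : ∀ i j, Rc i j = 1 / 2 * (a i j + a j i - b i j - c i j) := by
    intro i j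
    rw [hRc, ha, hb, hc]
    simp only [← Finset.mul_sum, Finset.sum_add_distrib, Finset.sum_sub_distrib]
    have e1 : ∑ k, H k i k j = ∑ k, H i k k j := Finset.sum_congr rfl fun k _ => hH _ _ _ _
    have e2 : ∑ k, H j i k k = ∑ k, H i j k k := Finset.sum_congr rfl fun k _ => hH _ _ _ _
    rw [e1, e2]
    ring
  have hbc : ∑ i, b i i = ∑ i, c i i := Finset.sum_comm
  have hS : ∑ i, Rc i i = ∑ i, a i i - ∑ i, c i i := by
    simp only [hR, ← Finset.mul_sum, Finset.sum_add_distrib, Finset.sum_sub_distrib, hbc]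
    ring
  -- The left side is ∂_k m_i. Its trace is the linearized scalar curvature, which is why the term
  -- -x_j ∂_k m_k of the superpotential reproduces the trace part of the Einstein tensor.
  have hM : ∀ i k, ∑ l, (H i l l k - H l l i k) = a i k - c i k := by
    intro i k
    rw [Finset.sum_sub_distrib]
    congr 1
    exact Finset.sum_congr rfl fun l _ => hH' _ _ _ _
  have hcs : ∀ i k, c i k = c k i := fun i k => Finset.sum_congr rfl fun l _ => hH' _ _ _ _
  have hdm : ∑ k, (d k k j - d k j k) = -m j := by
    rw [hm, ← Finset.sum_neg_distrib]
    exact Finset.sum_congr rfl fun k _ => by rw [hd k j k]; ring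
  have hdm' : ∑ k, (∑ i, (1 : Matrix (Fin n) (Fin n) ℝ) k i * (d i k j - d i j k)) = -m j := by
    simp only [Matrix.one_apply, ite_mul, one_mul, zero_mul, Finset.sum_ite_eq, Finset.mem_univ,
      if_true, hdm]
  have hxx : ∑ k, ∑ i, x i * (H i k j k - H i j k k) = ∑ i, x i * (a i j - b i j) := by
    rw [Finset.sum_comm]
    refine Finset.sum_congr rfl fun i _ => ?_
    rw [← Finset.mul_sum, Finset.sum_sub_distrib]
  have hδ : ∑ k, (1 : Matrix (Fin n) (Fin n) ℝ) k j * m k = m j := by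
    simp [Matrix.one_apply]
  have hδ' : ∑ i, 1 / 2 * (∑ a, Rc a a) * (1 : Matrix (Fin n) (Fin n) ℝ) i j * x i
      = 1 / 2 * (∑ a, Rc a a) * x j := by
    simp [Matrix.one_apply]
  -- Origin of the factor n - 2: the derivatives falling on the coordinates contribute -m_j
  -- (`hdm'`), n m_j (here) and -m_j (`hδ`).
  have hn : ∑ k : Fin n, (1 : Matrix (Fin n) (Fin n) ℝ) k k * m j = n * m j := by
    simp
  have e : ∑ i, Rc i j * x i = 1 / 2 * (∑ i, x i * (a i j - b i j) + ∑ k, x k * (a j k - c j k)) := by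
    rw [← Finset.sum_add_distrib, Finset.mul_sum]
    refine Finset.sum_congr rfl fun i _ => ?_
    rw [hR, hcs j i]
    ring
  simp only [sub_mul]
  rw [Finset.sum_sub_distrib, hδ', e, hS]
  simp only [hM, ← Finset.mul_sum, Finset.sum_sub_distrib, Finset.sum_add_distrib, hxx, hdm', hδ,
    hn]
  ring

namespace IsAsymptoticallyFlat

variable {g : MetricField n} {R τ : ℝ}

theorem differentiableAt_of_contDiffOn {f : E n → ℝ} (hf : ContDiffOn ℝ 1 f {x | R < ‖x‖})
    {x : E n} (hx : R < ‖x‖) : DifferentiableAt ℝ f x :=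
  (hf.contDiffAt ((isOpen_lt_norm R).mem_nhds hx)).differentiableAt one_ne_zero

theorem differentiableAt_dg (h : IsAsymptoticallyFlat g R τ) {x : E n} (hx : R < ‖x‖)
    (i j k : Fin n) : DifferentiableAt ℝ (dg g i j k) x :=
  differentiableAt_of_contDiffOn (h.contDiffOn_dg i j k) hx

theorem symm_apply (h : IsAsymptoticallyFlat g R τ) {x : E n} (hx : R < ‖x‖) (i j : Fin n) :
    g x i j = g x j i := by
  simpa using (h.posDef x hx).isHermitian.apply j i

theorem dg_symm (h : IsAsymptoticallyFlat g R τ) {x : E n} (hx : R < ‖x‖) (i j k : Fin n) :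
    dg g i j k x = dg g j i k x := by
  have e : (fun y => g y i j) =ᶠ[𝓝 x] fun y => g y j i := by
    filter_upwards [(isOpen_lt_norm R).mem_nhds hx] with y hy
    exact h.symm_apply hy i j
  rw [dg, dg, pderiv, pderiv, e.fderiv_eq]

theorem pderiv_dg_symm (h : IsAsymptoticallyFlat g R τ) {x : E n} (hx : R < ‖x‖)
    (i j k l : Fin n) : pderiv l (dg g i j k) x = pderiv l (dg g j i k) x := by
  have e : dg g i j k =ᶠ[𝓝 x] dg g j i k := by
    filter_upwards [(isOpen_lt_norm R).mem_nhds hx] with y hy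
    exact h.dg_symm hy i j k
  rw [pderiv, pderiv, e.fderiv_eq]

theorem pderiv_christoffelLow (h : IsAsymptoticallyFlat g R τ) {x : E n} (hx : R < ‖x‖)
    (l i j m : Fin n) : pderiv m (christoffelLow g l i j) x =
      pderiv m (dg g j l i) x + pderiv m (dg g i l j) x - pderiv m (dg g i j l) x := by
  have hd := h.differentiableAt_dg hx
  unfold christoffelLow
  rw [pderiv_sub m ((hd _ _ _).fun_add (hd _ _ _)) (hd _ _ _), pderiv_add m (hd _ _ _) (hd _ _ _)]

theorem pderiv_admFlux (h : IsAsymptoticallyFlat g R τ) {x : E n} (hx : R < ‖x‖) (i m : Fin n) :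
    pderiv m (admFlux g i) x = ∑ a, (pderiv m (dg g i a a) x - pderiv m (dg g a a i) x) := by
  have hd := h.differentiableAt_dg hx
  unfold admFlux
  rw [pderiv_sum m fun a _ => (hd _ _ _).fun_sub (hd _ _ _)]
  exact Finset.sum_congr rfl fun a _ => pderiv_sub m (hd _ _ _) (hd _ _ _)

theorem pderiv_superpotential (h : IsAsymptoticallyFlat g R τ) {x : E n} (hx : R < ‖x‖)
    (j k : Fin n) : pderiv k (superpotential g j k) x =
      1 / 2 * (∑ i, ((1 : Matrix (Fin n) (Fin n) ℝ) k i * (dg g i k j x - dg g i j k x)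
          + x i * (pderiv k (dg g i k j) x - pderiv k (dg g i j k) x))
        + (((1 : Matrix (Fin n) (Fin n) ℝ) k k * admFlux g j x
            + x k * ∑ a, (pderiv k (dg g j a a) x - pderiv k (dg g a a j) x))
          - ((1 : Matrix (Fin n) (Fin n) ℝ) k j * admFlux g k x
            + x j * ∑ a, (pderiv k (dg g k a a) x - pderiv k (dg g a a k) x)))) := by
  have hd := h.differentiableAt_dg hx
  have hm : ∀ i, DifferentiableAt ℝ (admFlux g i) x :=
    fun i => differentiableAt_of_contDiffOn (h.contDiffOn_admFlux i) hx
  have hx' : ∀ i, DifferentiableAt ℝ (fun y : E n => y i) x :=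
    fun i => (contDiff_coord i).contDiffAt.differentiableAt one_ne_zero
  have h1 : ∀ i, DifferentiableAt ℝ (fun y : E n => y i * (dg g i k j y - dg g i j k y)) x :=
    fun i => (hx' i).fun_mul ((hd _ _ _).fun_sub (hd _ _ _))
  have h2 : ∀ a b, DifferentiableAt ℝ (fun y : E n => y a * admFlux g b y) x :=
    fun a b => (hx' a).fun_mul (hm b)
  have h3 : DifferentiableAt ℝ (fun y : E n => ∑ i, y i * (dg g i k j y - dg g i j k y)) x :=
    DifferentiableAt.fun_sum fun i _ => h1 i
  unfold superpotential
  rw [pderiv_const_mul k (h3.fun_add ((h2 _ _).fun_sub (h2 _ _))),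
    pderiv_add k h3 ((h2 _ _).fun_sub (h2 _ _)), pderiv_sub k (h2 _ _) (h2 _ _),
    pderiv_sum k fun i _ => h1 i, pderiv_mul k (hx' _) (hm _), pderiv_mul k (hx' _) (hm _)]
  simp only [pderiv_mul k (hx' _) ((hd _ _ _).fun_sub (hd _ _ _)), pderiv_sub k (hd _ _ _) (hd _ _ _),
    pderiv_coord, h.pderiv_admFlux hx]

/-- The linearized Einstein tensor contracted with the position vector is a divergence of an
antisymmetric tensor up to a multiple of the ADM flux. -/
theorem sum_linEinstein_mul_coord (h : IsAsymptoticallyFlat g R τ) {x : E n} (hx : R < ‖x‖)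
    (j : Fin n) : ∑ i, linEinstein g i j x * x i =
      ∑ k, pderiv k (superpotential g j k) x - ((n : ℝ) - 2) / 2 * admFlux g j x := by
  simp only [h.pderiv_superpotential hx]
  exact einstein_superpotential_identity (fun i j k => dg g i j k x)
    (fun i j k l => pderiv l (dg g i j k) x) x (fun i => admFlux g i x)
    (fun i j => linRicci g i j x) (h.dg_symm hx) (h.pderiv_dg_symm hx)
    (fun i j k l => pderiv_pderiv_comm (h.contDiffOn i j) (isOpen_lt_norm R) hx l k)
    (fun i => rfl) (fun i j => by simp only [linRicci, h.pderiv_christoffelLow hx]) j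

end IsAsymptoticallyFlat

/-! ### Decay of the curvature and of its deviation from the linearization. -/

namespace IsAsymptoticallyFlat

variable {g : MetricField n} {R τ : ℝ}

theorem boundedDecay_metric (h : IsAsymptoticallyFlat g R τ) (i j : Fin n) :
    BoundedDecay 0 fun x => g x i j :=
  boundedDecay_zero_of_tendsto (tendsto_sub_nhds_zero_iff.1 ((h.decays i j).tendsto_zero h.nonneg))

theorem decays_inv_sub_one (h : IsAsymptoticallyFlat g R τ) (i j : Fin n) :
    Decays τ fun x => (g x)⁻¹ i j - (1 : Matrix (Fin n) (Fin n) ℝ) i j := by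
  have hd : DifferentiableAt ℝ (fun M : Fin n → Fin n → ℝ => (Matrix.of M)⁻¹ i j)
      (1 : Matrix (Fin n) (Fin n) ℝ) := by
    refine (contDiffAt_matrix_inv (k := 1) (M := fun M : Fin n → Fin n → ℝ => Matrix.of M)
      (x := (1 : Matrix (Fin n) (Fin n) ℝ)) (fun a b => ?_) ?_ i j).differentiableAt one_ne_zero
    · exact (contDiff_apply_apply ℝ ℝ a b).contDiffAt
    · exact (Matrix.det_one (R := ℝ) (n := Fin n)).trans_ne one_ne_zero
  have := decays_comp_sub h.nonneg h.decays hd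
  have e : (Matrix.of (1 : Matrix (Fin n) (Fin n) ℝ))⁻¹ = (1 : Matrix (Fin n) (Fin n) ℝ) :=
    inv_one
  simp only [e] at this
  exact this

/-- The coefficient is a differentiable function of the matrix g near the identity, so it inherits
the rate at which g approaches δ. -/
theorem decays_conormalCoeff_sub_one (h : IsAsymptoticallyFlat g R τ) (i j : Fin n) :
    Decays τ fun x => conormalCoeff g i j x - (1 : Matrix (Fin n) (Fin n) ℝ) i j := by
  have h1 : ∀ a b : Fin n, ContDiffAt ℝ 1 (fun M : Fin n → Fin n → ℝ => (Matrix.of M) a b)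
      (1 : Matrix (Fin n) (Fin n) ℝ) := fun a b => (contDiff_apply_apply ℝ ℝ a b).contDiffAt
  have h0 : (Matrix.of (1 : Matrix (Fin n) (Fin n) ℝ)).det = 1 := Matrix.det_one
  have hd : DifferentiableAt ℝ
      (fun M : Fin n → Fin n → ℝ => √((Matrix.of M).det) * (Matrix.of M)⁻¹ i j)
      (1 : Matrix (Fin n) (Fin n) ℝ) :=
    (((contDiffAt_matrix_det h1).sqrt (h0.trans_ne one_ne_zero)).mul
      (contDiffAt_matrix_inv h1 (h0.trans_ne one_ne_zero) i j)).differentiableAt one_ne_zero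
  have := decays_comp_sub h.nonneg h.decays hd
  have e : (Matrix.of (1 : Matrix (Fin n) (Fin n) ℝ))⁻¹ = (1 : Matrix (Fin n) (Fin n) ℝ) :=
    inv_one
  simp only [e, h0, Real.sqrt_one, one_mul] at this
  exact this

theorem boundedDecay_inv (h : IsAsymptoticallyFlat g R τ) (i j : Fin n) :
    BoundedDecay 0 fun x => (g x)⁻¹ i j :=
  boundedDecay_zero_of_tendsto
    (tendsto_sub_nhds_zero_iff.1 ((h.decays_inv_sub_one i j).tendsto_zero h.nonneg))

theorem boundedDecay_conormalCoeff (h : IsAsymptoticallyFlat g R τ) (i j : Fin n) :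
    BoundedDecay 0 (conormalCoeff g i j) :=
  boundedDecay_zero_of_tendsto
    (tendsto_sub_nhds_zero_iff.1 ((h.decays_conormalCoeff_sub_one i j).tendsto_zero h.nonneg))

/-- Differentiate g⁻¹ g = 1 and multiply by g⁻¹ on the right. -/
theorem pderiv_inv (h : IsAsymptoticallyFlat g R τ) {x : E n} (hx : R < ‖x‖) (i j m : Fin n) :
    pderiv m (fun y => (g y)⁻¹ i j) x =
      -∑ a, ∑ b, (g x)⁻¹ i a * dg g a b m x * (g x)⁻¹ b j := by
  have hxn := (isOpen_lt_norm R).mem_nhds (show x ∈ {x : E n | R < ‖x‖} from hx)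
  have hγ : ∀ a b, DifferentiableAt ℝ (fun y => (g y)⁻¹ a b) x := fun a b =>
    ((h.contDiffOn_inv a b).contDiffAt hxn).differentiableAt two_ne_zero
  have hg : ∀ a b, DifferentiableAt ℝ (fun y => g y a b) x := fun a b =>
    ((h.contDiffOn a b).contDiffAt hxn).differentiableAt two_ne_zero
  set P : Matrix (Fin n) (Fin n) ℝ := Matrix.of fun a b => pderiv m (fun y => (g y)⁻¹ a b) x with hP
  set Q : Matrix (Fin n) (Fin n) ℝ := Matrix.of fun a b => dg g a b m x with hQ
  have hu : IsUnit (g x).det := (h.det_pos hx).ne'.isUnit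
  have h1 : P * g x + (g x)⁻¹ * Q = 0 := by
    ext a b
    have e : (fun y => ∑ c, (g y)⁻¹ a c * g y c b) =ᶠ[𝓝 x]
        fun _ => (1 : Matrix (Fin n) (Fin n) ℝ) a b := by
      filter_upwards [hxn] with y hy
      rw [← Matrix.mul_apply, Matrix.nonsing_inv_mul _ (h.det_pos hy).ne'.isUnit]
    have e1 : pderiv m (fun y => ∑ c, (g y)⁻¹ a c * g y c b) x = 0 := by
      rw [pderiv, e.fderiv_eq]; simp
    rw [pderiv_sum m fun c _ => (hγ _ _).fun_mul (hg _ _)] at e1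
    simp only [pderiv_mul m (hγ _ _) (hg _ _), Finset.sum_add_distrib] at e1
    simp only [Matrix.add_apply, Matrix.mul_apply, Matrix.zero_apply]
    exact e1
  have h2 : P = -((g x)⁻¹ * Q * (g x)⁻¹) := by
    have : P * g x * (g x)⁻¹ = -((g x)⁻¹ * Q) * (g x)⁻¹ := by
      rw [eq_neg_of_add_eq_zero_left h1]
    rwa [Matrix.mul_assoc, Matrix.mul_nonsing_inv _ hu, Matrix.mul_one, Matrix.neg_mul] at this
  have h3 : P i j = -((g x)⁻¹ * Q * (g x)⁻¹) i j := by rw [h2]; rfl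
  rw [show pderiv m (fun y => (g y)⁻¹ i j) x = P i j from rfl, h3]
  congr 1
  simp only [Matrix.mul_apply, Finset.sum_mul]
  rw [Finset.sum_comm]
  rfl

theorem decays_pderiv_inv (h : IsAsymptoticallyFlat g R τ) (i j m : Fin n) :
    Decays (τ + 1) (pderiv m fun y => (g y)⁻¹ i j) := by
  have h1 : Decays (τ + 1) fun x => -1 * ∑ a, ∑ b, (g x)⁻¹ i a * dg g a b m x * (g x)⁻¹ b j :=
    (Decays.sum fun a _ => Decays.sum fun b _ =>
      (((h.boundedDecay_inv i a).mul_decays (h.decays_dg a b m)).mul_boundedDecay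
        (h.boundedDecay_inv b j)).mono (by linarith)).const_mul (-1)
  refine h1.congr ?_
  filter_upwards [eventually_lt_norm R] with x hx
  rw [h.pderiv_inv hx, neg_one_mul]

theorem decays_christoffelLow (h : IsAsymptoticallyFlat g R τ) (l i j : Fin n) :
    Decays (τ + 1) (christoffelLow g l i j) :=
  ((h.decays_dg _ _ _).add (h.decays_dg _ _ _)).sub (h.decays_dg _ _ _)

theorem decays_pderiv_christoffelLow (h : IsAsymptoticallyFlat g R τ) (l i j m : Fin n) :
    Decays (τ + 2) (pderiv m (christoffelLow g l i j)) := by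
  refine (((h.decays_ddg j l i m).add (h.decays_ddg i l j m)).sub (h.decays_ddg i j l m)).congr ?_
  filter_upwards [eventually_lt_norm R] with x hx
  exact h.pderiv_christoffelLow hx l i j m

theorem decays_christoffel (h : IsAsymptoticallyFlat g R τ) (k i j : Fin n) :
    Decays (τ + 1) (christoffel g k i j) :=
  (Decays.sum fun l _ => ((h.boundedDecay_inv k l).mul_decays
    (h.decays_christoffelLow l i j)).mono (by linarith)).const_mul (1 / 2)

/-- The product rule leaves (∂g⁻¹) times a lowered symbol, of weight (τ + 1) + (τ + 1), and (g⁻¹ -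
1) times the derivative of a lowered symbol, of weight τ + (τ + 2). -/
theorem decays_pderiv_christoffel_sub (h : IsAsymptoticallyFlat g R τ) (k i j m : Fin n) :
    Decays (2 * τ + 2) fun x =>
      pderiv m (christoffel g k i j) x - 1 / 2 * pderiv m (christoffelLow g k i j) x := by
  have h1 : Decays (2 * τ + 2) fun x => 1 / 2 * ∑ l,
      (pderiv m (fun y => (g y)⁻¹ k l) x * christoffelLow g l i j x
        + ((g x)⁻¹ k l - (1 : Matrix (Fin n) (Fin n) ℝ) k l) * pderiv m (christoffelLow g l i j) x) :=
    (Decays.sum fun l _ =>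
      (((h.decays_pderiv_inv k l m).mul_boundedDecay
        (h.decays_christoffelLow l i j).boundedDecay).mono (by linarith)).add
      (((h.decays_inv_sub_one k l).mul_boundedDecay
        (h.decays_pderiv_christoffelLow l i j m).boundedDecay).mono (by linarith))).const_mul (1 / 2)
  refine h1.congr ?_
  filter_upwards [eventually_lt_norm R] with x hx
  have hxn := (isOpen_lt_norm R).mem_nhds (show x ∈ {x : E n | R < ‖x‖} from hx)
  have hγ : ∀ a b, DifferentiableAt ℝ (fun y => (g y)⁻¹ a b) x := fun a b =>
    ((h.contDiffOn_inv a b).contDiffAt hxn).differentiableAt two_ne_zero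
  have hc : ∀ l, DifferentiableAt ℝ (christoffelLow g l i j) x := fun l =>
    differentiableAt_of_contDiffOn (h.contDiffOn_christoffelLow l i j) hx
  have e : pderiv m (christoffel g k i j) x = 1 / 2 * ∑ l,
      (pderiv m (fun y => (g y)⁻¹ k l) x * christoffelLow g l i j x
        + (g x)⁻¹ k l * pderiv m (christoffelLow g l i j) x) := by
    have e0 : christoffel g k i j = fun y => 1 / 2 * ∑ l, (g y)⁻¹ k l * christoffelLow g l i j y := rfl
    rw [e0, pderiv_const_mul m (DifferentiableAt.fun_sum fun l _ => (hγ k l).fun_mul (hc l)),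
      pderiv_sum m fun l _ => (hγ k l).fun_mul (hc l)]
    simp only [pderiv_mul m (hγ _ _) (hc _)]
  have e2 : ∑ l, (1 : Matrix (Fin n) (Fin n) ℝ) k l * pderiv m (christoffelLow g l i j) x
      = pderiv m (christoffelLow g k i j) x := by
    simp [Matrix.one_apply]
  rw [e, ← e2]
  simp only [sub_mul, Finset.sum_add_distrib, Finset.sum_sub_distrib]
  ring

/-- The terms quadratic in the Christoffel symbols already have weight 2(τ + 1); only the two
derivative terms need linearizing. -/
theorem decays_ricci_sub (h : IsAsymptoticallyFlat g R τ) (i j : Fin n) :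
    Decays (2 * τ + 2) fun x => ricci g i j x - linRicci g i j x := by
  have hΓ : ∀ a b c a' b' c' : Fin n, Decays (2 * τ + 2) fun x =>
      christoffel g a b c x * christoffel g a' b' c' x := fun a b c a' b' c' =>
    ((h.decays_christoffel a b c).mul_boundedDecay
      (h.decays_christoffel a' b' c').boundedDecay).mono (by linarith)
  have h1 := (((Decays.sum (s := Finset.univ) fun k _ => h.decays_pderiv_christoffel_sub k j i k).sub
    (Decays.sum (s := Finset.univ) fun k _ => h.decays_pderiv_christoffel_sub k k i j)).add
    (Decays.sum (s := Finset.univ) fun k _ => Decays.sum (s := Finset.univ) fun l _ =>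
      hΓ k k l l j i)).sub
    (Decays.sum (s := Finset.univ) fun k _ => Decays.sum (s := Finset.univ) fun l _ =>
      hΓ k j l l k i)
  refine h1.congr (Eventually.of_forall fun x => ?_)
  simp only [ricci, linRicci, Finset.sum_sub_distrib]
  ring

theorem decays_linRicci (h : IsAsymptoticallyFlat g R τ) (i j : Fin n) :
    Decays (τ + 2) (linRicci g i j) :=
  (Decays.sum fun _ _ => (h.decays_pderiv_christoffelLow _ _ _ _).const_mul _).sub
    (Decays.sum fun _ _ => (h.decays_pderiv_christoffelLow _ _ _ _).const_mul _)

theorem decays_linScalar (h : IsAsymptoticallyFlat g R τ) : Decays (τ + 2) (linScalar g) :=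
  Decays.sum fun i _ => h.decays_linRicci i i

theorem decays_scalarCurv_sub (h : IsAsymptoticallyFlat g R τ) :
    Decays (2 * τ + 2) fun x => scalarCurv g x - linScalar g x := by
  have hτ := h.nonneg
  have h1 : Decays (2 * τ + 2) fun x => ∑ i, ∑ j,
      ((g x)⁻¹ i j * (ricci g i j x - linRicci g i j x)
        + ((g x)⁻¹ i j - (1 : Matrix (Fin n) (Fin n) ℝ) i j) * linRicci g i j x) :=
    Decays.sum fun i _ => Decays.sum fun j _ =>
      (((h.boundedDecay_inv i j).mul_decays (h.decays_ricci_sub i j)).mono (by linarith)).add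
      (((h.decays_inv_sub_one i j).mul_boundedDecay (h.decays_linRicci i j).boundedDecay).mono
        (by linarith))
  refine h1.congr (Eventually.of_forall fun x => ?_)
  have e : linScalar g x = ∑ i, ∑ j, (1 : Matrix (Fin n) (Fin n) ℝ) i j * linRicci g i j x := by
    simp [Matrix.one_apply, linScalar]
  simp only [e, scalarCurv, ← Finset.sum_sub_distrib]
  exact Finset.sum_congr rfl fun i _ => Finset.sum_congr rfl fun j _ => by ring

theorem decays_einstein_sub (h : IsAsymptoticallyFlat g R τ) (i j : Fin n) :
    Decays (2 * τ + 2) fun x => einstein g i j x - linEinstein g i j x := by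
  have h1 : Decays (2 * τ + 2) fun x => (ricci g i j x - linRicci g i j x)
      - (1 / 2 * ((scalarCurv g x - linScalar g x) * g x i j)
        + 1 / 2 * (linScalar g x * (g x i j - (1 : Matrix (Fin n) (Fin n) ℝ) i j))) :=
    (h.decays_ricci_sub i j).sub
      ((((h.decays_scalarCurv_sub.mul_boundedDecay (h.boundedDecay_metric i j)).mono
        (by linarith)).const_mul _).add
      (((h.decays_linScalar.mul_boundedDecay (h.decays i j).boundedDecay).mono
        (by linarith)).const_mul _))
  refine h1.congr (Eventually.of_forall fun x => ?_)
  simp only [einstein, linEinstein]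
  ring

theorem decays_linEinstein (h : IsAsymptoticallyFlat g R τ) (i j : Fin n) :
    Decays (τ + 2) (linEinstein g i j) := by
  refine ((h.decays_linRicci i j).sub ((h.decays_linScalar.const_mul
    ((1 : Matrix (Fin n) (Fin n) ℝ) i j / 2)))).congr (Eventually.of_forall fun x => ?_)
  simp only [linEinstein]
  ring

/-- The Ricci flux agrees with the flux of the linearized Einstein tensor up to terms that are
quadratic in the deviation of the metric from the Euclidean one. -/
theorem decays_ricciFlux_sub (h : IsAsymptoticallyFlat g R τ) (k : Fin n) :
    Decays (2 * τ + 1) fun x => ricciFlux g k x - ∑ i, linEinstein g i k x * x i := by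
  -- First the Einstein tensor is replaced by its linearization, then the conormal coefficient by δ.
  -- The weights are (2τ + 2) - 1 and (τ + 2) - 1 + τ, where the -1 comes from the coordinate x_i.
  have h1 : Decays (2 * τ + 1) fun x => ∑ i, ∑ j,
      ((einstein g i j x - linEinstein g i j x) * x i * conormalCoeff g j k x
        + linEinstein g i j x * x i *
          (conormalCoeff g j k x - (1 : Matrix (Fin n) (Fin n) ℝ) j k)) :=
    Decays.sum fun i _ => Decays.sum fun j _ =>
      ((((h.decays_einstein_sub i j).mul_boundedDecay (boundedDecay_coord i)).mul_boundedDecay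
        (h.boundedDecay_conormalCoeff j k)).mono (by linarith)).add
      ((((h.decays_linEinstein i j).mul_boundedDecay (boundedDecay_coord i)).mul_boundedDecay
        (h.decays_conormalCoeff_sub_one j k).boundedDecay).mono (by linarith))
  refine h1.congr (Eventually.of_forall fun x => ?_)
  have e : ∑ i, linEinstein g i k x * x i = ∑ i, ∑ j,
      linEinstein g i j x * x i * (1 : Matrix (Fin n) (Fin n) ℝ) j k := by
    simp [Matrix.one_apply]
  simp only [e, ricciFlux, ← Finset.sum_sub_distrib]
  exact Finset.sum_congr rfl fun i _ => Finset.sum_congr rfl fun j _ => by ring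

end IsAsymptoticallyFlat

/-! ### The two fluxes through a Lipschitz surface. -/

section Flux

variable {g : MetricField n} {D : Set (E n)}

theorem admIntegrand_eq_sum (g : MetricField n) (D : Set (E n)) (x : E n) :
    admIntegrand g D x = ∑ i, admFlux g i x * normalE D x i := by
  simp only [admIntegrand, admFlux, Finset.sum_mul]

/-- The root of `conormSq` cancels between the normal and the area density, so the flux becomes
linear in the Euclidean normal with continuous coefficients. Where `normalE` has its default value
0, both sides vanish. -/
theorem normalG_mul_areaDensity {x : E n} (hx : (g x).PosDef) (j : Fin n) :
    normalG g D x j * areaDensity g D x = ∑ k, conormalCoeff g j k x * normalE D x k := by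
  have hsum : ∑ k, conormalCoeff g j k x * normalE D x k
      = √((g x).det) * ∑ k, (g x)⁻¹ j k * normalE D x k := by
    rw [Finset.mul_sum]
    exact Finset.sum_congr rfl fun k _ => by rw [conormalCoeff, mul_assoc]
  rw [hsum, normalG, areaDensity]
  by_cases hν : normalE D x = 0
  · simp [hν]
  · have hpos : 0 < conormSq g D x := by
      have hne : (normalE D x).ofLp ≠ 0 := fun h => hν (by ext i; exact congrFun h i)
      have := hx.inv.dotProduct_mulVec_pos hne
      have e : conormSq g D x =
          star (normalE D x).ofLp ⬝ᵥ ((g x)⁻¹.mulVec (normalE D x).ofLp) := by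
        simp only [conormSq, dotProduct, Matrix.mulVec, Finset.mul_sum, Pi.star_apply, star_trivial]
        exact Finset.sum_congr rfl fun i _ => Finset.sum_congr rfl fun k _ => by ring
      rwa [e]
    have := (Real.sqrt_pos.2 hpos).ne'
    field_simp

theorem ricciIntegrand_eq_sum {x : E n} (hx : (g x).PosDef) :
    ricciIntegrand g D x = ∑ k, ricciFlux g k x * normalE D x k := by
  have e : ricciIntegrand g D x =
      ∑ i, ∑ j, einstein g i j x * x i * (normalG g D x j * areaDensity g D x) := by
    simp only [ricciIntegrand, Finset.sum_mul, einstein]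
    exact Finset.sum_congr rfl fun i _ => Finset.sum_congr rfl fun j _ => by ring
  rw [e]
  simp only [normalG_mul_areaDensity hx, ricciFlux, Finset.sum_mul, Finset.mul_sum]
  conv_rhs => rw [Finset.sum_comm]
  refine Finset.sum_congr rfl fun i _ => ?_
  rw [Finset.sum_comm]
  exact Finset.sum_congr rfl fun k _ => Finset.sum_congr rfl fun j _ => by ring

theorem inner_single_normalE (k : Fin n) (x : E n) :
    ⟪EuclideanSpace.single k (1 : ℝ), normalE D x⟫_ℝ = normalE D x k := by
  simp [EuclideanSpace.inner_single_left]

theorem HasLipschitzBoundary.integrableOn_mul_normalE (hn : 2 ≤ n)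
    (hD : HasLipschitzBoundary D) (hb : Bornology.IsBounded D) {c : E n → ℝ}
    (hc : ContinuousOn c (frontier D)) (k : Fin n) :
    IntegrableOn (fun x => c x * normalE D x k) (frontier D) μHE[n - 1] := by
  have := hD.integrableOn_mul_inner_normalE hn hb hc (EuclideanSpace.single k (1 : ℝ))
  simpa only [inner_single_normalE] using this

namespace IsAsymptoticallyFlat

variable {R τ : ℝ}

theorem fluxesExist (h : IsAsymptoticallyFlat g R τ) (hn : 2 ≤ n) (hD : HasLipschitzBoundary D)
    (hb : Bornology.IsBounded D) (hR : frontier D ⊆ {x | R < ‖x‖}) : FluxesExist g D := by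
  constructor
  · have h1 : IntegrableOn (fun x => ∑ i, admFlux g i x * normalE D x i) (frontier D) μHE[n - 1] :=
      integrable_finsetSum _ fun i _ =>
        hD.integrableOn_mul_normalE hn hb ((h.continuousOn_admFlux i).mono hR) i
    exact h1.congr_fun (fun x _ => (admIntegrand_eq_sum g D x).symm)
      isClosed_frontier.measurableSet
  · have h1 : IntegrableOn (fun x => ∑ i, ricciFlux g i x * normalE D x i) (frontier D)
        μHE[n - 1] :=
      integrable_finsetSum _ fun i _ =>
        hD.integrableOn_mul_normalE hn hb ((h.continuousOn_ricciFlux i).mono hR) i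
    exact h1.congr_fun (fun x hx => (ricciIntegrand_eq_sum (h.posDef x (hR hx))).symm)
      isClosed_frontier.measurableSet

/-- By antisymmetry the integrand is half the sum over j, k of (ν_j ∂_k - ν_k ∂_j) U_jk. Each
summand is a tangential derivative of a C¹ function, to which Stokes' theorem applies. -/
theorem integral_divergence_superpotential (h : IsAsymptoticallyFlat g R τ) (hn : 2 ≤ n)
    (hD : HasLipschitzBoundary D) (hb : Bornology.IsBounded D)
    (hR : frontier D ⊆ {x | R < ‖x‖}) :
    ∫ x in frontier D, (∑ j, (∑ k, pderiv k (superpotential g j k) x) * normalE D x j)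
      ∂μHE[n - 1] = 0 := by
  have hint : ∀ j k a b, IntegrableOn (fun x => pderiv a (superpotential g j k) x * normalE D x b)
      (frontier D) μHE[n - 1] := fun j k a b =>
    hD.integrableOn_mul_normalE hn hb ((continuousOn_pderiv (h.contDiffOn_superpotential j k) a).mono
      hR) b
  have hint2 : ∀ j k, IntegrableOn (fun x => pderiv k (superpotential g j k) x * normalE D x j
      - pderiv j (superpotential g j k) x * normalE D x k) (frontier D) μHE[n - 1] :=
    fun j k => (hint j k k j).sub (hint j k j k)
  have hst : ∀ j k, ∫ x in frontier D, (pderiv k (superpotential g j k) x * normalE D x j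
      - pderiv j (superpotential g j k) x * normalE D x k) ∂μHE[n - 1] = 0 := by
    intro j k
    have := hD.integral_tangential_eq_zero hn hb (isOpen_lt_norm R) hR
      (h.contDiffOn_superpotential j k) (EuclideanSpace.single k 1) (EuclideanSpace.single j 1)
    simp only [inner_single_normalE] at this
    exact this
  have hanti : ∀ j k x, R < ‖x‖ →
      pderiv j (superpotential g k j) x = -pderiv j (superpotential g j k) x := by
    intro j k x hx
    rw [superpotential_antisymm g j k, pderiv_const_mul j
      (differentiableAt_of_contDiffOn (h.contDiffOn_superpotential j k) hx), neg_one_mul]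
  have e : ∀ x ∈ frontier D, ∑ j, (∑ k, pderiv k (superpotential g j k) x) * normalE D x j =
      1 / 2 * ∑ j, ∑ k, (pderiv k (superpotential g j k) x * normalE D x j
        - pderiv j (superpotential g j k) x * normalE D x k) := by
    intro x hx
    simp only [Finset.sum_sub_distrib, Finset.sum_mul]
    have e1 : ∑ j, ∑ k, pderiv j (superpotential g j k) x * normalE D x k =
        -∑ j, ∑ k, pderiv k (superpotential g j k) x * normalE D x j := by
      rw [Finset.sum_comm, ← Finset.sum_neg_distrib]
      refine Finset.sum_congr rfl fun j _ => ?_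
      rw [← Finset.sum_neg_distrib]
      refine Finset.sum_congr rfl fun k _ => ?_
      rw [hanti k j x (hR hx)]
      ring
    rw [e1]
    ring
  rw [setIntegral_congr_fun isClosed_frontier.measurableSet e, integral_const_mul,
    integral_finsetSum _ fun j _ => integrable_finsetSum _ fun k _ => hint2 j k]
  rw [Finset.sum_eq_zero, mul_zero]
  intro j _
  rw [integral_finsetSum _ fun k _ => hint2 j k]
  exact Finset.sum_eq_zero fun k _ => hst j k

/-- The Ricci flux and the ADM flux through a Lipschitz surface differ by the flux of the
quadratic remainder. -/
theorem integral_ricciIntegrand_add (h : IsAsymptoticallyFlat g R τ) (hn : 2 ≤ n)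
    (hD : HasLipschitzBoundary D) (hb : Bornology.IsBounded D)
    (hR : frontier D ⊆ {x | R < ‖x‖}) :
    (∫ x in frontier D, ricciIntegrand g D x ∂μHE[n - 1])
      + ((n : ℝ) - 2) / 2 * ∫ x in frontier D, admIntegrand g D x ∂μHE[n - 1] =
    ∫ x in frontier D, (∑ k, (ricciFlux g k x - ∑ i, linEinstein g i k x * x i) * normalE D x k)
      ∂μHE[n - 1] := by
  obtain ⟨h1, h2⟩ := h.fluxesExist hn hD hb hR
  have h3 : IntegrableOn (fun x => ∑ j, (∑ k, pderiv k (superpotential g j k) x) * normalE D x j)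
      (frontier D) μHE[n - 1] := integrable_finsetSum _ fun j _ =>
    hD.integrableOn_mul_normalE hn hb (ContinuousOn.mono (continuousOn_finsetSum _ fun k _ =>
      continuousOn_pderiv (h.contDiffOn_superpotential j k) k) hR) j
  have e : ∀ x ∈ frontier D,
      ∑ k, (ricciFlux g k x - ∑ i, linEinstein g i k x * x i) * normalE D x k =
      (ricciIntegrand g D x + ((n : ℝ) - 2) / 2 * admIntegrand g D x)
        - ∑ j, (∑ k, pderiv k (superpotential g j k) x) * normalE D x j := by
    intro x hx
    rw [ricciIntegrand_eq_sum (h.posDef x (hR hx)), admIntegrand_eq_sum, Finset.mul_sum,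
      ← Finset.sum_add_distrib, ← Finset.sum_sub_distrib]
    refine Finset.sum_congr rfl fun k _ => ?_
    rw [h.sum_linEinstein_mul_coord (hR hx)]
    ring
  have h4 : IntegrableOn (fun x => ((n : ℝ) - 2) / 2 * admIntegrand g D x) (frontier D)
      μHE[n - 1] := Integrable.const_mul h1 _
  have h5 : IntegrableOn (fun x => ricciIntegrand g D x + ((n : ℝ) - 2) / 2 * admIntegrand g D x)
      (frontier D) μHE[n - 1] := Integrable.add h2 h4
  rw [setIntegral_congr_fun isClosed_frontier.measurableSet e, integral_sub h5 h3,
    integral_add h2 h4,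
    h.integral_divergence_superpotential hn hD hb hR, integral_const_mul, sub_zero]

end IsAsymptoticallyFlat
end Flux

/-! ### Comparison of the two masses in the limit. -/

theorem innerRadius_le_norm {D : Set (E n)} {x : E n} (hx : x ∈ frontier D) :
    innerRadius D ≤ ‖x‖ :=
  ciInf_le ⟨0, by rintro _ ⟨y, rfl⟩; exact norm_nonneg _⟩ (⟨x, hx⟩ : frontier D)

/-- The difference of the two masses of surfaces going to infinity with controlled area tends to
zero. -/
theorem IsAsymptoticallyFlat.tendsto_admMass_sub_ricciMass {g : MetricField n} {R : ℝ}
    (hn : 3 ≤ n) (h : IsAsymptoticallyFlat g R (((n : ℝ) - 2) / 2)) {ι : Type*} {L : Filter ι}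
    {D : ι → Set (E n)}
    (hD : ∀ᶠ l in L, Bornology.IsBounded (D l) ∧ HasLipschitzBoundary (D l))
    (hr : Tendsto (fun l => innerRadius (D l)) L atTop) {C : ℝ}
    (hC : ∀ᶠ l in L, μHE[n - 1] (frontier (D l)) ≤
      ENNReal.ofReal (C * innerRadius (D l) ^ (n - 1))) :
    (∀ᶠ l in L, FluxesExist g (D l)) ∧
      Tendsto (fun l => admMass g (D l) - ricciMass g (D l)) L (𝓝 0) := by
  have hn2 : 2 ≤ n := by omega
  have hfar : ∀ ρ : ℝ, ∀ᶠ l in L, frontier (D l) ⊆ {x | ρ < ‖x‖} := fun ρ => by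
    filter_upwards [hr.eventually_gt_atTop ρ] with l hl x hx
    exact hl.trans_le (innerRadius_le_norm hx)
  refine ⟨?_, ?_⟩
  · filter_upwards [hD, hfar R] with l hl hR
    exact h.fluxesExist hn2 hl.2 hl.1 hR
  set err : E n → ℝ := fun x => ∑ k, |ricciFlux g k x - ∑ i, linEinstein g i k x * x i| with herr
  have herrd : Decays ((n : ℝ) - 1) err := by
    refine (Decays.sum fun k _ => ?_)
    -- With τ = (n - 2)/2 the rate 2τ + 1 equals n - 1, the growth exponent of the area.
    have := (h.decays_ricciFlux_sub k).mono (b := (n : ℝ) - 1) (by linarith)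
    exact Asymptotics.IsLittleO.abs_left this
  set J : ι → ℝ := fun l => ∫ x in frontier (D l), ricciIntegrand g (D l) x ∂μHE[n - 1]
      + ((n : ℝ) - 2) / 2 * ∫ x in frontier (D l), admIntegrand g (D l) x ∂μHE[n - 1] with hJ
  have hJ0 : Tendsto J L (𝓝 0) := by
    rw [Metric.tendsto_nhds]
    intro ε hε
    -- The final bound is ε |C| / (|C| + 1), strictly below ε whatever the sign of C.
    have hδ : 0 < ε / (|C| + 1) := by positivity
    obtain ⟨ρ, -, hρ⟩ := (hasBasis_cobounded_norm (E := E n)).eventually_iff.1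
      (Asymptotics.isLittleO_iff.1 herrd hδ)
    filter_upwards [hD, hfar R, hC, hr.eventually_gt_atTop ρ, hr.eventually_gt_atTop 0]
      with l hl hR hCl hlρ hl0
    set r := innerRadius (D l) with hrl
    have hbound : ∀ x ∈ frontier (D l),
        ‖∑ k, (ricciFlux g k x - ∑ i, linEinstein g i k x * x i) * normalE (D l) x k‖
          ≤ ε / (|C| + 1) * r ^ (-((n : ℝ) - 1)) := by
      intro x hx
      have hrx := innerRadius_le_norm hx
      have h1 := hρ (hlρ.le.trans hrx)
      rw [Real.norm_of_nonneg (by positivity : 0 ≤ ‖x‖ ^ (-((n : ℝ) - 1)))] at h1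
      calc _ ≤ ∑ k, ‖(ricciFlux g k x - ∑ i, linEinstein g i k x * x i) * normalE (D l) x k‖ :=
            norm_sum_le _ _
        _ ≤ err x := by
            refine Finset.sum_le_sum fun k _ => ?_
            rw [norm_mul, Real.norm_eq_abs]
            exact mul_le_of_le_one_right (abs_nonneg _)
              ((PiLp.norm_apply_le _ k).trans (norm_normalE_le _ _))
        _ ≤ ‖err x‖ := Real.le_norm_self _
        _ ≤ _ := h1
        _ ≤ _ := by
            gcongr ?_ * ?_
            have : (1 : ℝ) ≤ n := by exact_mod_cast (by omega : 1 ≤ n)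
            exact Real.rpow_le_rpow_of_nonpos hl0 hrx (by linarith)
    have harea : (μHE[n - 1] : Measure (E n)).real (frontier (D l)) ≤ |C| * r ^ (n - 1) := by
      refine ENNReal.toReal_le_of_le_ofReal (by positivity) (hCl.trans ?_)
      refine ENNReal.ofReal_le_ofReal ?_
      gcongr
      exact le_abs_self C
    rw [dist_zero_right, hJ]
    simp only
    rw [h.integral_ricciIntegrand_add hn2 hl.2 hl.1 hR]
    refine (norm_setIntegral_le_of_norm_le_const (hl.2.measure_frontier_lt_top hl.1)
      hbound).trans_lt ?_
    have hpow : r ^ (-((n : ℝ) - 1)) = (r ^ (n - 1))⁻¹ := by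
      rw [Real.rpow_neg hl0.le, ← Real.rpow_natCast, Nat.cast_sub (by omega), Nat.cast_one]
    calc ε / (|C| + 1) * r ^ (-((n : ℝ) - 1)) * (μHE[n - 1] : Measure (E n)).real (frontier (D l))
        ≤ ε / (|C| + 1) * r ^ (-((n : ℝ) - 1)) * (|C| * r ^ (n - 1)) := by gcongr
      _ = ε * (|C| / (|C| + 1)) := by
          rw [hpow]
          field_simp
      _ < ε * 1 := by
          gcongr
          rw [div_lt_one (by positivity)]
          linarith
      _ = ε := mul_one ε
  -- The normalising constants are matched so that the difference of masses is a fixed multiple of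
  -- `J`.
  have hfin : ∀ l, admMass g (D l) - ricciMass g (D l) =
      1 / (((n : ℝ) - 1) * ((n : ℝ) - 2) * sphereArea n) * J l := by
    intro l
    have h3 : (3 : ℝ) ≤ n := by exact_mod_cast hn
    have ha : (n : ℝ) - 1 ≠ 0 := by linarith
    have hb : (n : ℝ) - 2 ≠ 0 := by linarith
    have hb' : 2 - (n : ℝ) ≠ 0 := by linarith
    have e1 : (1 : ℝ) / (2 * ((n : ℝ) - 1) * sphereArea n) =
        1 / (((n : ℝ) - 1) * ((n : ℝ) - 2) * sphereArea n) * (((n : ℝ) - 2) / 2) := by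
      field_simp
    have e2 : (1 : ℝ) / (((n : ℝ) - 1) * (2 - (n : ℝ)) * sphereArea n) =
        -(1 / (((n : ℝ) - 1) * ((n : ℝ) - 2) * sphereArea n)) := by
      rw [show (2 : ℝ) - n = -((n : ℝ) - 2) by ring, mul_neg, neg_mul, div_neg]
    simp only [admMass, ricciMass, hJ, e1, e2]
    ring
  simp only [hfin]
  simpa using hJ0.const_mul (1 / (((n : ℝ) - 1) * ((n : ℝ) - 2) * sphereArea n))

/-! ### Round balls as Lipschitz domains. -/

section Ball

/-- The upper half of a round sphere is a Lipschitz graph away from the equator. -/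
theorem lipschitzWith_sqrt_sub_min_sq {V : Type*} [NormedAddCommGroup V] {r : ℝ} (hr : 0 < r) :
    LipschitzWith 1 fun y : V => √(r ^ 2 - (min ‖y‖ (r / 2)) ^ 2) := by
  refine LipschitzWith.of_dist_le_mul fun y z => ?_
  set s := min ‖y‖ (r / 2) with hs
  set t := min ‖z‖ (r / 2) with ht
  have hs0 : 0 ≤ s := le_min (norm_nonneg _) (by positivity)
  have ht0 : 0 ≤ t := le_min (norm_nonneg _) (by positivity)
  have hs1 : s ≤ r / 2 := min_le_right _ _
  have ht1 : t ≤ r / 2 := min_le_right _ _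
  have hst : |s - t| ≤ ‖y - z‖ :=
    (abs_min_sub_min_le_max _ _ _ _).trans (by
      rw [sub_self, abs_zero, max_eq_left (abs_nonneg _)]
      exact abs_norm_sub_norm_le y z)
  -- Both roots are at least r/2 while s and t are at most r/2, so A + B ≥ r ≥ s + t. As |A² - B²| =
  -- |s² - t²|, the Lipschitz constant is 1.
  have ha : r / 2 ≤ √(r ^ 2 - s ^ 2) := Real.le_sqrt_of_sq_le (by nlinarith)
  have hb : r / 2 ≤ √(r ^ 2 - t ^ 2) := Real.le_sqrt_of_sq_le (by nlinarith)
  have ha2 : √(r ^ 2 - s ^ 2) ^ 2 = r ^ 2 - s ^ 2 := Real.sq_sqrt (by nlinarith)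
  have hb2 : √(r ^ 2 - t ^ 2) ^ 2 = r ^ 2 - t ^ 2 := Real.sq_sqrt (by nlinarith)
  set A := √(r ^ 2 - s ^ 2)
  set B := √(r ^ 2 - t ^ 2)
  rw [Real.dist_eq, dist_eq_norm, NNReal.coe_one, one_mul]
  refine le_trans ?_ hst
  have hmul : |A - B| * (A + B) = |s - t| * (s + t) := by
    calc |A - B| * (A + B) = |(A - B) * (A + B)| := by
          rw [abs_mul, abs_of_pos (by linarith : 0 < A + B)]
      _ = |-((s - t) * (s + t))| := by congr 1; nlinarith
      _ = |s - t| * (s + t) := by rw [abs_neg, abs_mul, abs_of_nonneg (add_nonneg hs0 ht0)]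
  have h1 : |A - B| * r ≤ |s - t| * r := by
    calc |A - B| * r ≤ |A - B| * (A + B) := by gcongr; linarith
      _ = |s - t| * (s + t) := hmul
      _ ≤ |s - t| * r := by gcongr; linarith
  exact le_of_mul_le_mul_right h1 hr

theorem hasLipschitzBoundary_ball {r : ℝ} (hr : 0 < r) :
    HasLipschitzBoundary (Metric.ball (0 : E n) r) := by
  intro p hp
  rw [frontier_ball _ hr.ne', mem_sphere_zero_iff_norm] at hp
  set v : E n := r⁻¹ • p with hv
  have hv1 : ‖v‖ = 1 := by
    rw [hv, norm_smul, hp, Real.norm_of_nonneg (by positivity), inv_mul_cancel₀ hr.ne']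
  have hpv : p = r • v := by rw [hv, smul_inv_smul₀ hr.ne']
  have hprv : (ℝ ∙ v)ᗮ.orthogonalProjectionOnto v = 0 := by
    rw [Submodule.orthogonalProjectionOnto_eq_zero_iff, Submodule.orthogonal_orthogonal]
    exact Submodule.mem_span_singleton_self v
  -- The axis points to p. Inside the chart the cutoff at r/2, which makes the height globally
  -- Lipschitz, is inactive, and |x| < r is a bound on the height by Pythagoras.
  refine ⟨v, 1, fun y => √(r ^ 2 - (min ‖y‖ (r / 2)) ^ 2),
    {x | 0 < ⟪v, x⟫_ℝ ∧ ‖(ℝ ∙ v)ᗮ.orthogonalProjectionOnto x‖ < r / 2}, hv1,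
    lipschitzWith_sqrt_sub_min_sq hr, ?_, ?_, ?_⟩
  · have h1 : Continuous fun x : E n => ⟪v, x⟫_ℝ := by fun_prop
    have h2 : Continuous fun x : E n => ‖(ℝ ∙ v)ᗮ.orthogonalProjectionOnto x‖ := by fun_prop
    exact (isOpen_lt continuous_const h1).inter (isOpen_lt h2 continuous_const)
  · constructor
    · rw [hpv, inner_smul_right, real_inner_self_eq_norm_sq, hv1]
      simpa using hr
    · rw [hpv, map_smul, hprv, smul_zero, norm_zero]
      positivity
  · rintro x ⟨hx1, hx2⟩
    rw [mem_ball_zero_iff]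
    change ‖x‖ < r ↔ ⟪v, x⟫_ℝ <
      √(r ^ 2 - (min ‖(ℝ ∙ v)ᗮ.orthogonalProjectionOnto x‖ (r / 2)) ^ 2)
    rw [min_eq_left hx2.le, Real.lt_sqrt hx1.le, ← sq_lt_sq₀ (norm_nonneg _) hr.le]
    conv_lhs => rw [← orthogonalProjection_add_inner_smul hv1 x]
    rw [norm_coe_add_smul_sq hv1]
    constructor <;> intro h <;> linarith

theorem nontrivial_euclideanSpace (hn : 1 ≤ n) : Nontrivial (E n) := by
  apply Module.nontrivial_of_finrank_pos (R := ℝ)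
  rw [finrank_euclideanSpace_fin]
  omega

theorem innerRadius_ball (hn : 1 ≤ n) {r : ℝ} (hr : 0 < r) :
    innerRadius (Metric.ball (0 : E n) r) = r := by
  have := nontrivial_euclideanSpace hn
  have hf := frontier_ball (0 : E n) hr.ne'
  obtain ⟨z, hz⟩ := (NormedSpace.sphere_nonempty (x := (0 : E n)) (r := r)).2 hr.le
  have : Nonempty (frontier (Metric.ball (0 : E n) r)) := ⟨⟨z, hf ▸ hz⟩⟩
  have e : ∀ x : frontier (Metric.ball (0 : E n) r), ‖(x : E n)‖ = r := fun x =>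
    mem_sphere_zero_iff_norm.1 (hf ▸ x.2)
  rw [innerRadius]
  simp only [e, ciInf_const]

open scoped Pointwise in
-- The sphere is r times the unit sphere, and the measure scales by r^(n-1). The unit sphere has
-- finite area, so `toReal` in `sphereArea` loses nothing.
theorem measure_frontier_ball_le {r : ℝ} (hn : 1 ≤ n) (hr : 0 < r) :
    (μHE[n - 1] : Measure (E n)) (frontier (Metric.ball (0 : E n) r)) ≤
      ENNReal.ofReal (sphereArea n * innerRadius (Metric.ball (0 : E n) r) ^ (n - 1)) := by
  have := nontrivial_euclideanSpace hn
  have hfin : (μHE[n - 1] : Measure (E n)) (Metric.sphere 0 1) ≠ ∞ := by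
    rw [← frontier_ball (0 : E n) one_ne_zero]
    exact ((hasLipschitzBoundary_ball one_pos).measure_frontier_lt_top Metric.isBounded_ball).ne
  have hs : Metric.sphere (0 : E n) r = r • Metric.sphere (0 : E n) 1 := by
    rw [smul_sphere' hr.ne', smul_zero, Real.norm_of_nonneg hr.le, mul_one]
  rw [innerRadius_ball hn hr, frontier_ball _ hr.ne', hs,
    Measure.euclideanHausdorffMeasure_smul₀ _ hr.ne', sphereArea, mul_comm,
    ENNReal.ofReal_mul (by positivity), ENNReal.ofReal_toReal hfin, ENNReal.smul_def, smul_eq_mul,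
    ENNReal.ofReal_pow hr.le, ENNReal.coe_pow]
  gcongr
  exact (Real.enorm_eq_ofReal hr.le).le

end Ball

end AFEnd

end

/-! ### The main theorem. -/

theorem theorem2 (n : ℕ) (hn : 3 ≤ n) (g : AFEnd.MetricField n) (R₀ : ℝ)
    (hpos : ∀ x : AFEnd.E n, R₀ < ‖x‖ → (g x).PosDef)
    (hdecay : ∀ i j : Fin n, AFEnd.IsLittleOk 2 (((n : ℝ) - 2) / 2)
      (fun x => g x i j - (1 : Matrix (Fin n) (Fin n) ℝ) i j)) :
    ((∀ᶠ r : ℝ in atTop, AFEnd.FluxesExist g (Metric.ball 0 r)) ∧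
      Tendsto (fun r : ℝ => AFEnd.admMass g (Metric.ball 0 r) - AFEnd.ricciMass g (Metric.ball 0 r))
        atTop (𝓝 0)) ∧
    ∀ D : ℕ → Set (AFEnd.E n),
      (∀ l, IsOpen (D l) ∧ Bornology.IsBounded (D l) ∧ AFEnd.HasLipschitzBoundary (D l)) →
      Tendsto (fun l => AFEnd.innerRadius (D l)) atTop atTop →
      (∃ C : ℝ, ∀ l, μHE[n - 1] (frontier (D l)) ≤
        ENNReal.ofReal (C * AFEnd.innerRadius (D l) ^ (n - 1))) →
      (∀ᶠ l in atTop, AFEnd.FluxesExist g (D l)) ∧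
        Tendsto (fun l => AFEnd.admMass g (D l) - AFEnd.ricciMass g (D l)) atTop (𝓝 0) := by
  have h3 : (3 : ℝ) ≤ n := by exact_mod_cast hn
  obtain ⟨R, hg⟩ := AFEnd.exists_isAsymptoticallyFlat (by linarith) hpos hdecay
  constructor
  -- Spheres are the case of the filter of large radii, with area constant ω_{n-1}.
  · refine hg.tendsto_admMass_sub_ricciMass hn (C := AFEnd.sphereArea n) ?_ ?_ ?_
    · filter_upwards [eventually_gt_atTop 0] with r hr
      exact ⟨Metric.isBounded_ball, AFEnd.hasLipschitzBoundary_ball hr⟩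
    · refine tendsto_id.congr' ?_
      filter_upwards [eventually_gt_atTop 0] with r hr
      exact (AFEnd.innerRadius_ball (by omega) hr).symm
    · filter_upwards [eventually_gt_atTop 0] with r hr
      exact AFEnd.measure_frontier_ball_le (by omega) hr
  · rintro D hD hr ⟨C, hC⟩
    exact hg.tendsto_admMass_sub_ricciMass hn (Eventually.of_forall fun l => (hD l).2) hr
      (Eventually.of_forall hC)
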